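/- Let $\Theta\subset\mathbb{R}^d$ be a nonempty compact set, $\sigma>0$, and let $p_0$ be any probability density on $\mathbb{R}^d$. Let $\mathcal{P}(\Theta)$ be the set of probability measures supported on $\Theta$, let $\phi_\sigma$ be the density of $\mathcal{N}(0,\sigma^2 I_d)$, and for $G\in\mathcal{P}(\Theta)$ write $(\phi_\sigma * G)(x)=\int_\Theta\phi_\sigma(x-\theta)\,dG(\theta)$. Then there exists $G_\sigma\in\mathcal{P}(\Theta)$ with the following properties. 1. $\phi_\sigma * G_\sigma$ is a KL projection of $p_0$ onto $\mathcal{M}_\sigma(\Theta)=\{\phi_\sigma * G: G\in\mathcal{P}(\Theta)\}$, that is, $\mathrm{KL}(p_0\,\|\,\phi_\sigma * G_\sigma)=\min_{G\in\mathcal{P}(\Theta)}\mathrm{KL}(p_0\,\|\,\phi_\sigma * G)$ in $[0,\infty]$, where $\mathrm{KL}(p\,\|\,q)=\int p\log(p/q)$. If $\mathrm{KL}(p_0\,\|\,\phi_\sigma * G)<\infty$ for some $G\in\mathcal{P}(\Theta)$, then $G_\sigma$ is the only element of $\mathcal{P}(\Theta)$ with this property. 2. For every density $p_0$ (also if all these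 divergences are infinite), $G_\sigma$ is the unique element of $\mathcal{P}(\Theta)$ that is a projection when divergences are compared through their difference: for every $H\in\mathcal{P}(\Theta)$ the integral $\int p_0\log\frac{\phi_\sigma * G_\sigma}{\phi_\sigma * H}$ is well defined in $(-\infty,\infty]$ and is nonnegative. 3. For all $n$ and $y_1,\dots,y_n\in\mathbb{R}^d$, the log-likelihood $G\mapsto\sum_{i=1}^n\log(\phi_\sigma * G)(y_i)$ has a maximizer over $\mathcal{P}(\Theta)$. Let $Y_1,Y_2,\dots$ be i.i.d. with density $p_0$. For each $r\in[1,\infty)$, almost surely, for every choice of maximizers $$\widehat G_{n,\sigma}\in\operatorname*{arg\,max}_{G\in\mathcal{P}(\Theta)}\ \sum_{i=1}^n\log(\phi_\sigma * G)(Y_i),\qquad n\ge 1,$$ we have $W_r(\widehat G_{n,\sigma},G_\sigma)\to 0$ as $n\to\infty$, where $$W_r(P,Q)=\Big(\inf_{\gamma}\int|x-y|^r\,d\gamma(x,y)\Big)^{1/r},$$ the infimum being over all couplings $\gamma$ of $P$ and $Q$. -/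

import Mathlib

open MeasureTheory ProbabilityTheory Filter Topology InformationTheory
open scoped ENNReal

noncomputable section

namespace GaussMix

/-- `ℝ^d` with its Euclidean norm. -/
abbrev Euc (d : ℕ) : Type := EuclideanSpace ℝ (Fin d)

/-- `p` is a probability density on `ℝ^d` (with respect to Lebesgue measure). -/
structure IsDensity {d : ℕ} (p : Euc d → ℝ) : Prop where
  measurable : Measurable p
  nonneg : ∀ x, 0 ≤ p x
  lintegral_eq_one : ∫⁻ x, ENNReal.ofReal (p x) = 1

/-- The measure `p(x) dx` on `ℝ^d`. -/
def densityMeasure {d : ℕ} (p : Euc d → ℝ) : Measure (Euc d) :=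
  (volume : Measure (Euc d)).withDensity fun x => ENNReal.ofReal (p x)

/-- The set of all probability measures on `ℝ^d` that are supported on `Θ`. -/
def probOn {d : ℕ} (Θ : Set (Euc d)) : Set (Measure (Euc d)) :=
  {G | IsProbabilityMeasure G ∧ G Θᶜ = 0}

/-- The density `φ_σ` of the centred Gaussian on `ℝ^d` with covariance `σ² I_d`. -/
def gaussianDensity {d : ℕ} (σ : ℝ) (x : Euc d) : ℝ :=
  (Real.sqrt (2 * Real.pi * σ ^ 2) ^ d)⁻¹ * Real.exp (-‖x‖ ^ 2 / (2 * σ ^ 2))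

/-- The convolution `φ_σ * G`, that is, `x ↦ ∫ φ_σ(x - θ) dG(θ)`. -/
def mixture {d : ℕ} (σ : ℝ) (G : Measure (Euc d)) (x : Euc d) : ℝ :=
  ∫ θ, gaussianDensity σ (x - θ) ∂G

/-- The Kullback-Leibler divergence `KL(p ‖ q) = ∫ p log (p / q) ∈ [0, ∞]` of two densities. -/
def KL {d : ℕ} (p q : Euc d → ℝ) : ℝ≥0∞ :=
  klDiv (densityMeasure p) (densityMeasure q)

/-- `φ_σ * G` minimizes `KL(p₀ ‖ ·)` over the family `{φ_σ * H : H ∈ P(Θ)}`. -/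
def IsKLProjection {d : ℕ} (Θ : Set (Euc d)) (σ : ℝ) (p₀ : Euc d → ℝ) (G : Measure (Euc d)) :
    Prop :=
  G ∈ probOn Θ ∧ ∀ H ∈ probOn Θ, KL p₀ (mixture σ G) ≤ KL p₀ (mixture σ H)

/-- The comparison of Kullback-Leibler divergences through their difference:
`KL(p₀ ‖ φ_σ * H) - KL(p₀ ‖ φ_σ * G)`, read as the single integral
`∫ p₀ log ((φ_σ * G) / (φ_σ * H))`, is well defined in `(-∞, ∞]` (its negative part is finite)
and nonnegative, for every `H ∈ P(Θ)`.  This is meaningful also where both divergences are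
infinite. -/
def IsRelKLProjection {d : ℕ} (Θ : Set (Euc d)) (σ : ℝ) (p₀ : Euc d → ℝ)
    (G : Measure (Euc d)) : Prop :=
  G ∈ probOn Θ ∧ ∀ H ∈ probOn Θ,
    -- the negative part of the integral is finite
    ∫⁻ x, ENNReal.ofReal (-Real.log (mixture σ G x / mixture σ H x)) ∂(densityMeasure p₀) ≠ ∞ ∧
    -- and it is at most the positive part
    ∫⁻ x, ENNReal.ofReal (-Real.log (mixture σ G x / mixture σ H x)) ∂(densityMeasure p₀) ≤
      ∫⁻ x, ENNReal.ofReal (Real.log (mixture σ G x / mixture σ H x)) ∂(densityMeasure p₀)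

/-- `G` is a nonparametric maximum likelihood estimator for the first `n` terms
`y 0, …, y (n - 1)` of the sample: it maximizes the log-likelihood
`∑ log (φ_σ * H)(y i)` over all `H ∈ P(Θ)`. -/
def IsNPMLE {d : ℕ} (Θ : Set (Euc d)) (σ : ℝ) (y : ℕ → Euc d) (n : ℕ) (G : Measure (Euc d)) :
    Prop :=
  G ∈ probOn Θ ∧ ∀ H ∈ probOn Θ,
    ∑ i ∈ Finset.range n, Real.log (mixture σ H (y i)) ≤
      ∑ i ∈ Finset.range n, Real.log (mixture σ G (y i))

/-- The couplings of `P` and `Q`: measures on the product with marginals `P` and `Q`. -/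
def couplings {d : ℕ} (P Q : Measure (Euc d)) : Set (Measure (Euc d × Euc d)) :=
  {γ | γ.map Prod.fst = P ∧ γ.map Prod.snd = Q}

/-- The Wasserstein distance `W_r`, with values in `[0, ∞]`. -/
def wasserstein {d : ℕ} (r : ℝ) (P Q : Measure (Euc d)) : ℝ≥0∞ :=
  (⨅ γ ∈ couplings P Q, ∫⁻ z, edist z.1 z.2 ^ r ∂γ) ^ (1 / r)

end GaussMix

end

/-!
Why the theorem holds. Write `f_G` for the mixture `φ_σ * G` and `P` for the law with density `p₀`.

*A numeraire.* Everything rests on one mixing measure `G` with `∫ f_H / f_G dP ≤ 1` for every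
`H ∈ P(Θ)` (`exists_forall_lintegral_mixture_div_le_one`). This is the first order condition for
maximizing `∫ log f_G dP`, but unlike that criterion it makes sense for every `p₀`. For a finite
measure carried by a compact set the criterion is continuous on the weakly compact set `P(Θ)`, so a
maximizer exists, and differentiating along segments gives the first order condition
(`integral_mixture_div_le_of_maximizer`). Applying this to `P` restricted to growing balls, a
cluster point of the maximizers is the wanted `G`.

*Projection.* Jensen's inequality turns `∫ f_H / f_G dP ≤ 1` into `∫ log (f_G / f_H) dP ≥ 0`, with
finite negative part (`lintegral_log_le_lintegral_neg_log`), and hence into minimality of the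
divergence (`KL_le_KL`). In the equality case `f_H = f_G` holds `P`-almost everywhere, so on a set
of positive Lebesgue measure. Up to a Gaussian factor, mixtures are Laplace transforms of compactly
supported measures, hence real analytic, and so they agree everywhere; since the Laplace transform
determines the measure, `H = G` (`eq_of_mixture_eq_on`).

*Estimation.* Existence of the maximum likelihood estimator and its first order condition are the
case of an empirical measure. The strong law in the Banach space `C(P(Θ), ℝ)` is a law of large
numbers uniform in the mixing measure, so a cluster point `K` of the estimators inherits
`∫ f_G / f_K dP ≤ 1` from the empirical first order conditions. Together with
`∫ f_K / f_G dP ≤ 1` this forces `K = G` (`ae_tendsto_of_isNPMLE`). Weak convergence on a compact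
space is then turned into convergence of transport costs by an explicit coupling along a fine
partition of unity (`exists_coupling_of_partition`).
-/

noncomputable section

namespace GaussMix

/-! ### Identifiability of Gaussian mixtures -/

theorem eq_zero_of_analyticOnNhd_of_volume_ne_zero {f : ℝ → ℝ}
    (hf : AnalyticOnNhd ℝ f Set.univ) (h : volume {t | f t = 0} ≠ 0) (t : ℝ) : f t = 0 := by
  by_contra hne
  refine h (measure_null_of_locally_null _ fun x _ => ⟨{x}, ?_, measure_singleton x⟩)
  have hev : ∀ᶠ s in 𝓝[≠] x, f s ≠ 0 := by
    by_contra hfr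
    refine hne (hf.eqOn_zero_of_preconnected_of_frequently_eq_zero isPreconnected_univ
      (Set.mem_univ x) (fun h' => hfr h') (Set.mem_univ t))
  rw [eventually_nhdsWithin_iff] at hev
  filter_upwards [nhdsWithin_le_nhds hev, self_mem_nhdsWithin] with s hs hs0
  by_contra hsx
  exact hs hsx hs0

/-- A function that is real analytic along every coordinate line and vanishes on a set of positive
measure vanishes identically. By Fubini's theorem this follows by induction on the dimension. -/
theorem eq_zero_of_analyticOnNhd_update {n : ℕ} {g : (Fin n → ℝ) → ℝ} (hm : Measurable g)
    (hg : ∀ x i, AnalyticOnNhd ℝ (fun t => g (Function.update x i t)) Set.univ)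
    (h : volume {x | g x = 0} ≠ 0) (x : Fin n → ℝ) : g x = 0 := by
  induction n with
  | zero =>
    obtain ⟨y, hy⟩ := nonempty_of_measure_ne_zero h
    rw [Subsingleton.elim x y]; exact hy
  | succ n ih =>
    have hmp := (volume_preserving_piFinSuccAbove (fun _ : Fin (n + 1) => ℝ) 0).symm
    have hZ : MeasurableSet {x | g x = 0} := measurableSet_eq_fun hm measurable_const
    rw [← hmp.measure_preimage hZ.nullMeasurableSet, Measure.volume_eq_prod, ne_eq,
      Measure.measure_prod_null (hmp.measurable hZ)] at h
    have hm' : Measurable fun p : ℝ × (Fin n → ℝ) => g (Fin.cons p.1 p.2) := by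
      refine hm.comp (measurable_pi_iff.2 fun i => ?_)
      refine Fin.cases ?_ (fun j => ?_) i
      · simpa using measurable_fst
      · simpa [Function.comp_def] using (measurable_pi_apply j).comp measurable_snd
    -- a first coordinate whose slice of the zero set is not null makes the slice identically zero
    have hslice (s : ℝ) (hs : volume {y : Fin n → ℝ | g (Fin.cons s y) = 0} ≠ 0)
        (y : Fin n → ℝ) : g (Fin.cons s y) = 0 := by
      refine ih (g := fun y => g (Fin.cons s y)) (hm'.comp measurable_prodMk_left)
        (fun y i => ?_) hs y
      simpa only [Fin.cons_update] using hg (Fin.cons s y) i.succ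
    have hpos : volume {s : ℝ | volume {y : Fin n → ℝ | g (Fin.cons s y) = 0} ≠ 0} ≠ 0 := by
      intro h0
      refine h (ae_iff.2 ?_)
      convert h0 using 3
      simp [Fin.insertNthEquiv, MeasurableEquiv.piFinSuccAbove, Set.preimage]
    rw [← Fin.cons_self_tail x]
    have h1 := eq_zero_of_analyticOnNhd_of_volume_ne_zero
      (f := fun t => g (Fin.cons t (Fin.tail x))) ?_ ?_ (x 0)
    · exact h1
    · simpa only [Fin.update_cons_zero] using hg (Fin.cons 0 (Fin.tail x)) 0
    · exact fun h0 => hpos (measure_mono_null (fun s hs => hslice s hs _) h0)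

theorem integrable_exp_mul_inner {d : ℕ} {μ : Measure (Euc d)} [IsFiniteMeasure μ] {R : ℝ}
    (hμ : ∀ᵐ θ ∂μ, ‖θ‖ ≤ R) (a : ℝ) (x : Euc d) :
    Integrable (fun θ => Real.exp (a * inner ℝ x θ)) μ := by
  refine Integrable.of_bound (C := Real.exp (|a| * (‖x‖ * R))) ?_ ?_
  · exact (Continuous.aestronglyMeasurable (by fun_prop))
  · filter_upwards [hμ] with θ hθ
    rw [Real.norm_of_nonneg (Real.exp_pos _).le, Real.exp_le_exp]
    calc a * inner ℝ x θ ≤ |a| * |inner ℝ x θ| := by rw [← abs_mul]; exact le_abs_self _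
      _ ≤ |a| * (‖x‖ * R) := by
        gcongr
        exact (abs_real_inner_le_norm x θ).trans (by gcongr)

/-- The Laplace transform of a boundedly supported measure is real analytic in each coordinate:
along a coordinate line it is the moment generating function of that coordinate under the measure
weighted by the remaining exponential factor. -/
theorem analyticOnNhd_laplace_update {d : ℕ} {μ : Measure (Euc d)} [IsFiniteMeasure μ] {R : ℝ}
    (hμ : ∀ᵐ θ ∂μ, ‖θ‖ ≤ R) (a : ℝ) (x : Fin d → ℝ) (i : Fin d) :
    AnalyticOnNhd ℝ
      (fun t => ∫ θ, Real.exp (a * inner ℝ (WithLp.toLp 2 (Function.update x i t)) θ) ∂μ)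
      Set.univ := by
  set w : Euc d → ℝ := fun θ =>
    Real.exp (a * inner ℝ (WithLp.toLp 2 (Function.update x i 0) : Euc d) θ) with hw
  have hwm : Measurable w := by fun_prop
  have hexp (t : ℝ) (θ : Euc d) :
      Real.exp (a * inner ℝ (WithLp.toLp 2 (Function.update x i t) : Euc d) θ)
        = w θ * Real.exp (t * (a * θ i)) := by
    have hupd : (WithLp.toLp 2 (Function.update x i t) : Euc d)
        = WithLp.toLp 2 (Function.update x i 0) + t • EuclideanSpace.single i 1 := by
      ext j
      by_cases hj : j = i
      · subst hj; simp
      · simp [hj]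
    have hsingle : inner ℝ (EuclideanSpace.single i (1 : ℝ)) θ = θ i := by
      simpa using EuclideanSpace.inner_single_left i (1 : ℝ) θ
    rw [hw, hupd, inner_add_left, inner_smul_left, ← Real.exp_add, hsingle]
    congr 1
    simp
    ring
  set ν := μ.withDensity (fun θ => ENNReal.ofReal (w θ)) with hν
  have hint (t : ℝ) : Integrable (fun θ : Euc d => Real.exp (t * (a * θ i))) ν := by
    rw [hν, integrable_withDensity_iff_integrable_smul' hwm.ennreal_ofReal
      (ae_of_all _ fun _ => ENNReal.ofReal_lt_top)]
    refine (integrable_exp_mul_inner hμ a (WithLp.toLp 2 (Function.update x i t))).congr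
      (ae_of_all _ fun θ => ?_)
    simp only [hexp]
    rw [ENNReal.toReal_ofReal (Real.exp_pos _).le, smul_eq_mul]
  have hset : integrableExpSet (fun θ : Euc d => a * θ i) ν = Set.univ :=
    Set.eq_univ_of_forall hint
  have han := analyticOnNhd_mgf (X := fun θ : Euc d => a * θ i) (μ := ν)
  rw [hset, interior_univ] at han
  convert han using 2 with t
  rw [mgf, hν, integral_withDensity_eq_integral_toReal_smul hwm.ennreal_ofReal
    (ae_of_all _ fun _ => ENNReal.ofReal_lt_top)]
  refine integral_congr_ae (ae_of_all _ fun θ => ?_)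
  simp only [hexp]
  rw [ENNReal.toReal_ofReal (Real.exp_pos _).le, smul_eq_mul]

/-- Along each direction the Laplace transform is a moment generating function. It extends to the
complex plane, so it determines the characteristic function. -/
theorem eq_of_laplace_eq {d : ℕ} {μ ν : Measure (Euc d)} [IsFiniteMeasure μ] [IsFiniteMeasure ν]
    {R : ℝ} (hμ : ∀ᵐ θ ∂μ, ‖θ‖ ≤ R)
    (h : ∀ x : Euc d, ∫ θ, Real.exp (inner ℝ x θ) ∂μ = ∫ θ, Real.exp (inner ℝ x θ) ∂ν) :
    μ = ν := by
  have h0 : μ = 0 ↔ ν = 0 := by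
    have h1 := h 0
    simp only [inner_zero_left, Real.exp_zero, integral_const, smul_eq_mul, mul_one] at h1
    rw [← Measure.measure_univ_eq_zero, ← Measure.measure_univ_eq_zero,
      ← measureReal_eq_zero_iff, ← measureReal_eq_zero_iff, h1]
  refine Measure.ext_of_charFunDual (funext fun L => ?_)
  obtain ⟨u, rfl⟩ := (InnerProductSpace.toDual ℝ (Euc d)).surjective L
  set X : Euc d → ℝ := fun θ => inner ℝ u θ with hX
  have hmul (t : ℝ) (θ : Euc d) : t * X θ = inner ℝ (t • u) θ := by
    rw [inner_smul_left]; rfl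
  have hmgf : mgf X μ = mgf X ν := by
    funext t
    simp only [mgf, hmul]
    exact h _
  have hset : integrableExpSet X μ = Set.univ := by
    refine Set.eq_univ_of_forall fun t => ?_
    have := integrable_exp_mul_inner hμ 1 (t • u)
    simp only [one_mul, ← hmul] at this
    exact this
  have hc := eqOn_complexMGF_of_mgf' hmgf h0
  rw [hset, interior_univ] at hc
  have hXm : Measurable X := by fun_prop
  have hmap : μ.map X = ν.map X :=
    Measure.ext_of_complexMGF_eq hXm.aemeasurable hXm.aemeasurable
      (funext fun z => hc (Set.mem_univ _))
  have hXL : (⇑(InnerProductSpace.toDual ℝ (Euc d) u) : Euc d → ℝ) = X := by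
    funext θ; simp [hX]
  rw [charFunDual_eq_charFun_map_one, charFunDual_eq_charFun_map_one, hXL, hmap]

theorem eq_of_laplace_eq_on {d : ℕ} {μ ν : Measure (Euc d)} [IsFiniteMeasure μ]
    [IsFiniteMeasure ν] {R : ℝ} (hμ : ∀ᵐ θ ∂μ, ‖θ‖ ≤ R) (hν : ∀ᵐ θ ∂ν, ‖θ‖ ≤ R) {a : ℝ}
    (ha : a ≠ 0)
    (h : volume {x : Euc d | ∫ θ, Real.exp (a * inner ℝ x θ) ∂μ
      = ∫ θ, Real.exp (a * inner ℝ x θ) ∂ν} ≠ 0) :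
    μ = ν := by
  have hmeas (ρ : Measure (Euc d)) [IsFiniteMeasure ρ] :
      Measurable fun x : Fin d → ℝ =>
        ∫ θ, Real.exp (a * inner ℝ (WithLp.toLp 2 x : Euc d) θ) ∂ρ := by
    refine (StronglyMeasurable.integral_prod_right
      (f := fun (x : Fin d → ℝ) θ => Real.exp (a * inner ℝ (WithLp.toLp 2 x : Euc d) θ))
      ?_).measurable
    exact Continuous.stronglyMeasurable (by fun_prop)
  have hall := eq_zero_of_analyticOnNhd_update (n := d)
    (g := fun x => (∫ θ, Real.exp (a * inner ℝ (WithLp.toLp 2 x : Euc d) θ) ∂μ)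
      - ∫ θ, Real.exp (a * inner ℝ (WithLp.toLp 2 x : Euc d) θ) ∂ν)
    ((hmeas μ).sub (hmeas ν))
    (fun x i => (analyticOnNhd_laplace_update hμ a x i).sub
      (analyticOnNhd_laplace_update hν a x i)) ?_
  · refine eq_of_laplace_eq hμ fun x => ?_
    have h1 := sub_eq_zero.1 (hall (WithLp.ofLp (a⁻¹ • x)))
    simpa [inner_smul_left, ha] using h1
  · refine fun h0 => h ?_
    refine le_antisymm ?_ zero_le
    rw [← (PiLp.volume_preserving_toLp (Fin d)).measure_preimage_emb
      (MeasurableEquiv.toLp 2 (Fin d → ℝ)).measurableEmbedding]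
    refine (measure_mono fun x hx => ?_).trans h0.le
    exact sub_eq_zero.2 hx

/-- Expanding the square exhibits a mixture, up to the factor `φ_σ(x)`, as the Laplace transform of
the reweighted mixing measure. -/
theorem gaussianDensity_sub {d : ℕ} {σ : ℝ} (hσ : 0 < σ) (x θ : Euc d) :
    gaussianDensity σ (x - θ) = gaussianDensity σ x *
      (Real.exp (-‖θ‖ ^ 2 / (2 * σ ^ 2)) * Real.exp ((σ ^ 2)⁻¹ * inner ℝ x θ)) := by
  simp only [gaussianDensity]
  rw [mul_assoc (_ ^ d)⁻¹, ← Real.exp_add, ← Real.exp_add, norm_sub_sq_real]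
  congr 2
  field_simp
  ring

theorem gaussianDensity_pos {d : ℕ} {σ : ℝ} (hσ : 0 < σ) (x : Euc d) :
    0 < gaussianDensity σ x := by
  unfold gaussianDensity
  positivity

/-- **Identifiability.** A Gaussian mixture is determined by its mixing measure, even when it is
only known on a set of positive Lebesgue measure. -/
theorem eq_of_mixture_eq_on {d : ℕ} {Θ : Set (Euc d)} (hΘ : IsCompact Θ) {σ : ℝ} (hσ : 0 < σ)
    {G H : Measure (Euc d)} (hG : G ∈ probOn Θ) (hH : H ∈ probOn Θ)
    (h : volume {x | mixture σ G x = mixture σ H x} ≠ 0) : G = H := by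
  obtain ⟨R, hR⟩ := hΘ.isBounded.exists_norm_le
  have := hG.1
  have := hH.1
  set w : Euc d → ℝ := fun θ => Real.exp (-‖θ‖ ^ 2 / (2 * σ ^ 2)) with hw
  have hwm : Measurable w := by fun_prop
  have hbd {K : Measure (Euc d)} (hK : K ∈ probOn Θ) : ∀ᵐ θ ∂K, ‖θ‖ ≤ R :=
    Filter.mem_of_superset (mem_ae_iff.2 hK.2) fun θ hθ => hR θ hθ
  have hfin (K : Measure (Euc d)) [IsProbabilityMeasure K] :
      IsFiniteMeasure (K.withDensity fun θ => ENNReal.ofReal (w θ)) := by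
    refine isFiniteMeasure_withDensity_ofReal (Integrable.of_bound (C := 1)
      hwm.aestronglyMeasurable (ae_of_all _ fun θ => ?_)).2
    rw [Real.norm_of_nonneg (Real.exp_pos _).le, Real.exp_le_one_iff]
    exact div_nonpos_of_nonpos_of_nonneg (by simp) (by positivity)
  have hmix (K : Measure (Euc d)) (x : Euc d) : mixture σ K x = gaussianDensity σ x *
      ∫ θ, Real.exp ((σ ^ 2)⁻¹ * inner ℝ x θ) ∂K.withDensity fun θ => ENNReal.ofReal (w θ) := by
    rw [integral_withDensity_eq_integral_toReal_smul hwm.ennreal_ofReal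
      (ae_of_all _ fun _ => ENNReal.ofReal_lt_top), mixture, ← integral_const_mul]
    refine integral_congr_ae (ae_of_all _ fun θ => ?_)
    simp only [gaussianDensity_sub hσ]
    rw [ENNReal.toReal_ofReal (Real.exp_pos _).le, smul_eq_mul]
  have := hfin G
  have := hfin H
  have hac (K : Measure (Euc d)) := withDensity_absolutelyContinuous K
    (fun θ => ENNReal.ofReal (w θ))
  have heq : (G.withDensity fun θ => ENNReal.ofReal (w θ))
      = H.withDensity fun θ => ENNReal.ofReal (w θ) := by
    refine eq_of_laplace_eq_on ((hac G).ae_le (hbd hG)) ((hac H).ae_le (hbd hH))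
      (a := (σ ^ 2)⁻¹) (by positivity) ?_
    refine fun h0 => h (measure_mono_null (fun x hx => ?_) h0)
    have hx' : mixture σ G x = mixture σ H x := hx
    rw [hmix, hmix] at hx'
    exact mul_left_cancel₀ (gaussianDensity_pos hσ x).ne' hx'
  have hinv (K : Measure (Euc d)) : (K.withDensity fun θ => ENNReal.ofReal (w θ)).withDensity
      (fun θ => (ENNReal.ofReal (w θ))⁻¹) = K :=
    withDensity_inv_same hwm.ennreal_ofReal
      (ae_of_all _ fun θ => (ENNReal.ofReal_pos.2 (Real.exp_pos _)).ne')
      (ae_of_all _ fun _ => ENNReal.ofReal_ne_top)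
  rw [← hinv G, heq, hinv H]

/-! ### Continuity of mixtures in the mixing measure -/

/-- The measure on `ℝ^d` carried by `Θ` that a probability measure on the subtype `Θ` induces.
It identifies `probOn Θ` with `ProbabilityMeasure Θ`, which carries the weak topology. -/
def extend {d : ℕ} {Θ : Set (Euc d)} (g : ProbabilityMeasure Θ) : Measure (Euc d) :=
  (g : Measure Θ).map Subtype.val

theorem extend_mem_probOn {d : ℕ} {Θ : Set (Euc d)} (hΘ : MeasurableSet Θ)
    (g : ProbabilityMeasure Θ) : extend g ∈ probOn Θ := by
  refine ⟨Measure.isProbabilityMeasure_map measurable_subtype_coe.aemeasurable, ?_⟩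
  rw [extend, Measure.map_apply measurable_subtype_coe hΘ.compl]
  simp

theorem exists_extend_eq {d : ℕ} {Θ : Set (Euc d)} (hΘ : MeasurableSet Θ) {G : Measure (Euc d)}
    (hG : G ∈ probOn Θ) : ∃ g : ProbabilityMeasure Θ, extend g = G := by
  have := hG.1
  have hmap : (G.comap (Subtype.val : Θ → Euc d)).map Subtype.val = G := by
    rw [map_comap_subtype_coe hΘ, Measure.restrict_eq_self_of_ae_mem (mem_ae_iff.2 hG.2)]
  refine ⟨⟨G.comap Subtype.val, ⟨?_⟩⟩, hmap⟩
  rw [← Set.preimage_univ (f := (Subtype.val : Θ → Euc d)),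
    ← Measure.map_apply measurable_subtype_coe MeasurableSet.univ, hmap, measure_univ]

theorem continuous_gaussianDensity {d : ℕ} (σ : ℝ) :
    Continuous (gaussianDensity σ : Euc d → ℝ) := by
  unfold gaussianDensity
  fun_prop

theorem mixture_extend {d : ℕ} {Θ : Set (Euc d)} (σ : ℝ) (g : ProbabilityMeasure Θ)
    (x : Euc d) : mixture σ (extend g) x =
      ∫ θ : Θ, gaussianDensity σ (x - (θ : Euc d)) ∂(g : Measure Θ) := by
  have := continuous_gaussianDensity (d := d) σ
  rw [mixture, extend, integral_map measurable_subtype_coe.aemeasurable]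
  exact Continuous.aestronglyMeasurable (by fun_prop)

/-- Integration is jointly continuous in the integrand, for the uniform norm, and in the
probability measure, for the weak topology. -/
theorem continuous_integral_prod {X : Type*} [TopologicalSpace X] [MeasurableSpace X]
    [OpensMeasurableSpace X] :
    Continuous fun p : BoundedContinuousFunction X ℝ × ProbabilityMeasure X =>
      ∫ x, p.1 x ∂(p.2 : Measure X) := by
  refine continuous_iff_continuousAt.2 fun ⟨F, g⟩ => ?_
  have h1 : Tendsto (fun p : BoundedContinuousFunction X ℝ × ProbabilityMeasure X =>
      ∫ x, (p.1 - F) x ∂(p.2 : Measure X)) (𝓝 (F, g)) (𝓝 0) := by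
    refine squeeze_zero_norm (a := fun p => ‖p.1 - F‖)
      (fun p => (p.1 - F).norm_integral_le_norm (p.2 : Measure X)) ?_
    have : Continuous fun p : BoundedContinuousFunction X ℝ × ProbabilityMeasure X =>
      ‖p.1 - F‖ := by fun_prop
    simpa using this.tendsto (F, g)
  have h2 : Tendsto (fun p : BoundedContinuousFunction X ℝ × ProbabilityMeasure X =>
      ∫ x, F x ∂(p.2 : Measure X)) (𝓝 (F, g)) (𝓝 (∫ x, F x ∂(g : Measure X))) :=
    ((ProbabilityMeasure.continuous_integral_boundedContinuousFunction F).comp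
      continuous_snd).tendsto (F, g)
  have h3 := h1.add h2
  rw [zero_add] at h3
  refine h3.congr fun p => ?_
  rw [← integral_add ((p.1 - F).integrable _) (F.integrable _)]
  simp

theorem continuous_mixture_extend {d : ℕ} {Θ : Set (Euc d)} [CompactSpace Θ] (σ : ℝ) :
    Continuous fun p : Euc d × ProbabilityMeasure Θ => mixture σ (extend p.2) p.1 := by
  have hφ := continuous_gaussianDensity (d := d) σ
  let K : C(Euc d × Θ, ℝ) := ⟨fun q => gaussianDensity σ (q.1 - (q.2 : Euc d)), by fun_prop⟩
  have hK : Continuous fun x : Euc d =>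
      (BoundedContinuousFunction.mkOfCompact (K.curry x) : BoundedContinuousFunction Θ ℝ) :=
    (ContinuousMap.isometryEquivBoundedOfCompact Θ ℝ).continuous.comp K.curry.continuous
  have h := continuous_integral_prod.comp
    ((hK.comp continuous_fst).prodMk (continuous_snd (Y := ProbabilityMeasure Θ)))
  convert h using 2 with p
  exact mixture_extend σ p.2 p.1

theorem continuous_mixture {d : ℕ} {Θ : Set (Euc d)} (hΘ : IsCompact Θ) (σ : ℝ)
    {G : Measure (Euc d)} (hG : G ∈ probOn Θ) : Continuous (mixture σ G) := by
  have := isCompact_iff_compactSpace.1 hΘ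
  obtain ⟨g, rfl⟩ := exists_extend_eq hΘ.measurableSet hG
  exact (continuous_mixture_extend σ).comp (Continuous.prodMk_left g)

theorem gaussianDensity_le {d : ℕ} (σ : ℝ) (x : Euc d) :
    gaussianDensity σ x ≤ (Real.sqrt (2 * Real.pi * σ ^ 2) ^ d)⁻¹ := by
  refine mul_le_of_le_one_right (by positivity) (Real.exp_le_one_iff.2 ?_)
  exact div_nonpos_of_nonpos_of_nonneg (by simp) (by positivity)

theorem integrable_gaussianDensity_sub {d : ℕ} {σ : ℝ} (hσ : 0 < σ) (G : Measure (Euc d))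
    [IsFiniteMeasure G] (x : Euc d) : Integrable (fun θ => gaussianDensity σ (x - θ)) G := by
  have := continuous_gaussianDensity (d := d) σ
  refine Integrable.of_bound (C := (Real.sqrt (2 * Real.pi * σ ^ 2) ^ d)⁻¹)
    (Continuous.aestronglyMeasurable (by fun_prop)) (ae_of_all _ fun θ => ?_)
  rw [Real.norm_of_nonneg (gaussianDensity_pos hσ _).le]
  exact gaussianDensity_le σ _

theorem mixture_pos {d : ℕ} {σ : ℝ} (hσ : 0 < σ) (G : Measure (Euc d)) [IsProbabilityMeasure G]
    (x : Euc d) : 0 < mixture σ G x := by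
  refine (integral_pos_iff_support_of_nonneg (fun θ => (gaussianDensity_pos hσ _).le)
    (integrable_gaussianDensity_sub hσ G x)).2 ?_
  have : Function.support (fun θ => gaussianDensity σ (x - θ)) = Set.univ :=
    Set.eq_univ_of_forall fun θ => (gaussianDensity_pos hσ _).ne'
  rw [this, measure_univ]
  exact one_pos

theorem convexCombination_mem_probOn {d : ℕ} {Θ : Set (Euc d)} {G H : Measure (Euc d)}
    (hG : G ∈ probOn Θ) (hH : H ∈ probOn Θ) {t : ℝ} (ht0 : 0 ≤ t) (ht1 : t ≤ 1) :
    ENNReal.ofReal (1 - t) • G + ENNReal.ofReal t • H ∈ probOn Θ := by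
  have := hG.1
  have := hH.1
  refine ⟨⟨?_⟩, ?_⟩
  · simp only [Measure.coe_add, Measure.coe_smul, Pi.add_apply, Pi.smul_apply, measure_univ,
      smul_eq_mul, mul_one]
    rw [← ENNReal.ofReal_add (by linarith) ht0]
    simp
  · simp [hG.2, hH.2]

theorem mixture_convexCombination {d : ℕ} {σ : ℝ} (hσ : 0 < σ) (G H : Measure (Euc d))
    [IsFiniteMeasure G] [IsFiniteMeasure H] {t : ℝ} (ht0 : 0 ≤ t) (ht1 : t ≤ 1) (x : Euc d) :
    mixture σ (ENNReal.ofReal (1 - t) • G + ENNReal.ofReal t • H) x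
      = (1 - t) * mixture σ G x + t * mixture σ H x := by
  have hG := integrable_gaussianDensity_sub hσ G x
  have hH := integrable_gaussianDensity_sub hσ H x
  rw [mixture, integral_add_measure (hG.smul_measure ENNReal.ofReal_ne_top)
    (hH.smul_measure ENNReal.ofReal_ne_top), integral_smul_measure, integral_smul_measure,
    ENNReal.toReal_ofReal (by linarith), ENNReal.toReal_ofReal ht0]
  rfl

theorem integrable_of_ae_mem_compact {X : Type*} [TopologicalSpace X] [MeasurableSpace X]
    [OpensMeasurableSpace X] {E : Type*} [NormedAddCommGroup E]
    [SecondCountableTopologyEither X E] [TopologicalSpace.PseudoMetrizableSpace X] {ρ : Measure X}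
    [IsFiniteMeasure ρ] {B : Set X} (hB : IsCompact B) (hρ : ∀ᵐ x ∂ρ, x ∈ B) {h : X → E}
    (hh : Continuous h) : Integrable h ρ := by
  obtain ⟨C, hC⟩ := hB.exists_bound_of_continuousOn hh.continuousOn
  refine Integrable.of_bound (C := C) hh.aestronglyMeasurable ?_
  filter_upwards [hρ] with x hx using hC x hx

/-- Integrals over a compactly carried finite measure depend continuously on a parameter that
ranges over a compact space. No countability is asked of that space: the integral is taken in
the Banach space of continuous functions on it. -/
theorem continuous_integral_of_ae_mem_compact {X S : Type*} [TopologicalSpace X]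
    [SecondCountableTopology X] [TopologicalSpace.PseudoMetrizableSpace X]
    [MeasurableSpace X] [OpensMeasurableSpace X] [TopologicalSpace S] [CompactSpace S]
    {ρ : Measure X} [IsFiniteMeasure ρ]
    {B : Set X} (hB : IsCompact B) (hρ : ∀ᵐ x ∂ρ, x ∈ B) {h : X × S → ℝ} (hh : Continuous h) :
    Continuous fun s => ∫ x, h (x, s) ∂ρ := by
  let K : C(X × S, ℝ) := ⟨h, hh⟩
  have hint : Integrable (fun x => K.curry x) ρ :=
    integrable_of_ae_mem_compact hB hρ K.curry.continuous
  have h1 : (fun s => ∫ x, h (x, s) ∂ρ) = ⇑(∫ x, K.curry x ∂ρ) :=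
    funext fun s => (ContinuousMap.integral_apply hint s).symm
  rw [h1]
  exact (∫ x, K.curry x ∂ρ).continuous

/-! ### Maximizers of the log-likelihood and their first order condition -/

/-- A quadratic lower bound that controls the increment of a log-likelihood along a segment. -/
theorem sub_two_mul_sq_le_log_one_add {u : ℝ} (hu : -(1 / 2) ≤ u) :
    u - 2 * u ^ 2 ≤ Real.log (1 + u) := by
  have hpos : 0 < 1 + u := by linarith
  refine le_trans ?_ (Real.one_sub_inv_le_log_of_pos hpos)
  have h : 1 - (1 + u)⁻¹ - (u - 2 * u ^ 2) = u ^ 2 * (1 + 2 * u) / (1 + u) := by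
    field_simp
    ring
  have : 0 ≤ u ^ 2 * (1 + 2 * u) / (1 + u) :=
    div_nonneg (mul_nonneg (sq_nonneg u) (by linarith)) hpos.le
  linarith

theorem continuous_log_mixture_extend {d : ℕ} {Θ : Set (Euc d)} [CompactSpace Θ] {σ : ℝ}
    (hσ : 0 < σ) :
    Continuous fun p : Euc d × ProbabilityMeasure Θ => Real.log (mixture σ (extend p.2) p.1) := by
  refine (continuous_mixture_extend σ).log fun p => ?_
  have : IsProbabilityMeasure (extend p.2) :=
    Measure.isProbabilityMeasure_map measurable_subtype_coe.aemeasurable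
  exact (mixture_pos hσ _ _).ne'

theorem exists_maximizer_integral_log {d : ℕ} {Θ : Set (Euc d)} (hΘ : IsCompact Θ)
    (hΘne : Θ.Nonempty) {σ : ℝ} (hσ : 0 < σ) {ρ : Measure (Euc d)} [IsFiniteMeasure ρ]
    {B : Set (Euc d)} (hB : IsCompact B) (hρ : ∀ᵐ x ∂ρ, x ∈ B) :
    ∃ G ∈ probOn Θ, ∀ H ∈ probOn Θ,
      ∫ x, Real.log (mixture σ H x) ∂ρ ≤ ∫ x, Real.log (mixture σ G x) ∂ρ := by
  have := isCompact_iff_compactSpace.1 hΘ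
  have := hΘne.to_subtype
  obtain ⟨θ⟩ := this
  have : Nonempty (ProbabilityMeasure Θ) := ⟨⟨Measure.dirac θ, inferInstance⟩⟩
  obtain ⟨g, -, hg⟩ := isCompact_univ.exists_isMaxOn Set.univ_nonempty
    (continuous_integral_of_ae_mem_compact hB hρ
      (continuous_log_mixture_extend (Θ := Θ) hσ)).continuousOn
  refine ⟨extend g, extend_mem_probOn hΘ.measurableSet g, fun H hH => ?_⟩
  obtain ⟨h, rfl⟩ := exists_extend_eq hΘ.measurableSet hH
  exact hg (Set.mem_univ h)

/-- The first order condition at a maximizer of a concave log-likelihood: moving the mixing measure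
from `G` towards `H` does not increase the criterion to first order. -/
theorem integral_mixture_div_le_of_maximizer {d : ℕ} {Θ : Set (Euc d)} (hΘ : IsCompact Θ)
    {σ : ℝ} (hσ : 0 < σ) {ρ : Measure (Euc d)} [IsFiniteMeasure ρ]
    {B : Set (Euc d)} (hB : IsCompact B) (hρ : ∀ᵐ x ∂ρ, x ∈ B) {G : Measure (Euc d)}
    (hG : G ∈ probOn Θ)
    (hmax : ∀ H ∈ probOn Θ,
      ∫ x, Real.log (mixture σ H x) ∂ρ ≤ ∫ x, Real.log (mixture σ G x) ∂ρ)
    {H : Measure (Euc d)} (hH : H ∈ probOn Θ) :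
    ∫ x, mixture σ H x / mixture σ G x ∂ρ ≤ ρ.real Set.univ := by
  have := hG.1
  have := hH.1
  have hpos {K : Measure (Euc d)} (hK : K ∈ probOn Θ) (x : Euc d) : 0 < mixture σ K x :=
    have := hK.1; mixture_pos hσ K x
  have hlog {K : Measure (Euc d)} (hK : K ∈ probOn Θ) :
      Integrable (fun x => Real.log (mixture σ K x)) ρ :=
    integrable_of_ae_mem_compact hB hρ
      ((continuous_mixture hΘ σ hK).log fun x => (hpos hK x).ne')
  set u : Euc d → ℝ := fun x => mixture σ H x / mixture σ G x - 1 with hu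
  have hdiv : Continuous fun x => mixture σ H x / mixture σ G x :=
    (continuous_mixture hΘ σ hH).div (continuous_mixture hΘ σ hG) fun x => (hpos hG x).ne'
  have huc : Continuous u := hdiv.sub continuous_const
  have hui : Integrable u ρ := integrable_of_ae_mem_compact hB hρ huc
  have hu2 : Integrable (fun x => u x ^ 2) ρ :=
    integrable_of_ae_mem_compact hB hρ (huc.pow 2)
  have hu1 (x : Euc d) : -1 ≤ u x := by
    have := div_pos (hpos hH x) (hpos hG x)
    simp only [hu]
    linarith
  -- the increment of the criterion along the segment from `G` to `H`
  have hstep (t : ℝ) (ht0 : 0 < t) (ht1 : t ≤ 1 / 2) :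
      ∫ x, u x ∂ρ ≤ t * (2 * ∫ x, u x ^ 2 ∂ρ) := by
    have hmem := convexCombination_mem_probOn hG hH ht0.le (by linarith : t ≤ 1)
    have h1 := hmax _ hmem
    have h2 : ∫ x, (t * u x - 2 * t ^ 2 * u x ^ 2) ∂ρ ≤
        ∫ x, (Real.log (mixture σ (ENNReal.ofReal (1 - t) • G + ENNReal.ofReal t • H) x)
          - Real.log (mixture σ G x)) ∂ρ := by
      refine integral_mono ((hui.const_mul t).sub (hu2.const_mul _))
        ((hlog hmem).sub (hlog hG)) fun x => ?_
      have hx := hpos hG x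
      dsimp only
      rw [← Real.log_div (hpos hmem x).ne' hx.ne',
        mixture_convexCombination hσ G H ht0.le (by linarith)]
      have h3 : ((1 - t) * mixture σ G x + t * mixture σ H x) / mixture σ G x = 1 + t * u x := by
        simp only [hu]
        field_simp
        ring
      rw [h3]
      refine le_trans (le_of_eq (by ring)) (sub_two_mul_sq_le_log_one_add ?_)
      nlinarith [hu1 x]
    rw [integral_sub (hui.const_mul t) (hu2.const_mul _),
      integral_sub (hlog hmem) (hlog hG), integral_const_mul, integral_const_mul] at h2
    refine le_of_mul_le_mul_left ?_ ht0
    nlinarith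
  have hlim : Tendsto (fun t : ℝ => t * (2 * ∫ x, u x ^ 2 ∂ρ)) (𝓝[>] 0) (𝓝 0) := by
    have : Continuous fun t : ℝ => t * (2 * ∫ x, u x ^ 2 ∂ρ) := by fun_prop
    simpa using (this.tendsto 0).mono_left nhdsWithin_le_nhds
  have hle : ∫ x, u x ∂ρ ≤ 0 := by
    refine ge_of_tendsto hlim ?_
    filter_upwards [Ioc_mem_nhdsGT (by norm_num : (0 : ℝ) < 1 / 2)] with t ht
      using hstep t ht.1 ht.2
  have hdi : Integrable (fun x => mixture σ H x / mixture σ G x) ρ :=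
    integrable_of_ae_mem_compact hB hρ hdiv
  simp only [hu] at hle
  rw [integral_sub hdi (integrable_const _)] at hle
  simpa using hle

theorem integral_sum_dirac {d : ℕ} (y : ℕ → Euc d) (n : ℕ) (h : Euc d → ℝ) :
    ∫ x, h x ∂(∑ i ∈ Finset.range n, Measure.dirac (y i)) = ∑ i ∈ Finset.range n, h (y i) := by
  rw [integral_finsetSum_measure fun i _ => integrable_dirac (by simp)]
  simp

theorem isFiniteMeasure_sum_dirac {d : ℕ} (y : ℕ → Euc d) (n : ℕ) :
    IsFiniteMeasure (∑ i ∈ Finset.range n, Measure.dirac (y i)) :=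
  ⟨by simp [Measure.finsetSum_apply]⟩

theorem ae_sum_dirac_mem {d : ℕ} (y : ℕ → Euc d) (n : ℕ) :
    ∀ᵐ x ∂(∑ i ∈ Finset.range n, Measure.dirac (y i)), x ∈ y '' ↑(Finset.range n) := by
  rw [ae_iff, Measure.finsetSum_apply]
  refine Finset.sum_eq_zero fun i hi => ?_
  change Measure.dirac (y i) (y '' ↑(Finset.range n))ᶜ = 0
  rw [Measure.dirac_apply' _ ((((Finset.finite_toSet _).image y).measurableSet).compl)]
  simp only [Set.indicator_apply_eq_zero]
  exact fun h => absurd (Set.mem_image_of_mem y (Finset.mem_coe.2 hi)) h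

theorem exists_isNPMLE {d : ℕ} {Θ : Set (Euc d)} (hΘ : IsCompact Θ) (hΘne : Θ.Nonempty) {σ : ℝ}
    (hσ : 0 < σ) (y : ℕ → Euc d) (n : ℕ) : ∃ G, IsNPMLE Θ σ y n G := by
  have := isFiniteMeasure_sum_dirac y n
  obtain ⟨G, hG, hmax⟩ := exists_maximizer_integral_log hΘ hΘne hσ
    (((Finset.range n).finite_toSet.image y).isCompact) (ae_sum_dirac_mem y n)
  simp only [integral_sum_dirac] at hmax
  exact ⟨G, hG, hmax⟩

/-- The first order condition for the empirical measure, in unnormalized form. -/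
theorem IsNPMLE.sum_mixture_div_le {d : ℕ} {Θ : Set (Euc d)} (hΘ : IsCompact Θ) {σ : ℝ}
    (hσ : 0 < σ) {y : ℕ → Euc d} {n : ℕ} {G : Measure (Euc d)} (hG : IsNPMLE Θ σ y n G)
    {H : Measure (Euc d)} (hH : H ∈ probOn Θ) :
    ∑ i ∈ Finset.range n, mixture σ H (y i) / mixture σ G (y i) ≤ n := by
  have := isFiniteMeasure_sum_dirac y n
  have h := integral_mixture_div_le_of_maximizer hΘ hσ
    (((Finset.range n).finite_toSet.image y).isCompact) (ae_sum_dirac_mem y n) hG.1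
    (by simpa only [integral_sum_dirac] using hG.2) hH
  rw [integral_sum_dirac] at h
  simpa [Measure.real, Measure.finsetSum_apply] using h

theorem continuous_mixture_div_extend {d : ℕ} {Θ : Set (Euc d)} (hΘ : IsCompact Θ) {σ : ℝ}
    (hσ : 0 < σ) {H : Measure (Euc d)} (hH : H ∈ probOn Θ) :
    Continuous fun p : Euc d × ProbabilityMeasure Θ =>
      mixture σ H p.1 / mixture σ (extend p.2) p.1 := by
  have := isCompact_iff_compactSpace.1 hΘ
  refine ((continuous_mixture hΘ σ hH).comp continuous_fst).div (continuous_mixture_extend σ)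
    fun p => ?_
  have := (extend_mem_probOn hΘ.measurableSet p.2).1
  exact (mixture_pos hσ _ _).ne'

theorem ae_restrict_closedBall_mem {d : ℕ} (P : Measure (Euc d)) (r : ℝ) :
    ∀ᵐ x ∂(P.restrict (Metric.closedBall 0 r)), x ∈ Metric.closedBall (0 : Euc d) r :=
  ae_restrict_mem Metric.isClosed_closedBall.measurableSet

theorem lintegral_le_one_of_forall_closedBall {d : ℕ} {P : Measure (Euc d)} [IsFiniteMeasure P]
    {h : Euc d → ℝ} (hc : Continuous h) (h0 : ∀ x, 0 ≤ h x)
    (hle : ∀ m : ℕ, ∫ x in Metric.closedBall 0 (m : ℝ), h x ∂P ≤ 1) :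
    ∫⁻ x, ENNReal.ofReal (h x) ∂P ≤ 1 := by
  have hdir : Directed (· ⊆ ·) fun m : ℕ => Metric.closedBall (0 : Euc d) (m : ℝ) :=
    (monotone_nat_of_le_succ fun m => Metric.closedBall_subset_closedBall
      (by push_cast; linarith)).directed_le
  rw [← setLIntegral_univ, ← Metric.iUnion_closedBall_nat (0 : Euc d),
    setLIntegral_iUnion_of_directed _ hdir]
  refine iSup_le fun m => ?_
  have hint : Integrable h (P.restrict (Metric.closedBall 0 (m : ℝ))) :=
    integrable_of_ae_mem_compact (isCompact_closedBall 0 (m : ℝ))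
      (ae_restrict_closedBall_mem P m) hc
  rw [← ofReal_integral_eq_lintegral_ofReal hint (ae_of_all _ h0)]
  exact ENNReal.ofReal_le_one.2 (hle m)

/-- Some mixing measure `G` is such that the likelihood ratio of every competitor against it has
mean at most one.
It is obtained as a cluster point of the maximizers of the truncated criteria
`∫ log (φ_σ * G) dP` over balls, which are finite whatever `P` is. -/
theorem exists_forall_lintegral_mixture_div_le_one {d : ℕ} {Θ : Set (Euc d)} (hΘ : IsCompact Θ)
    (hΘne : Θ.Nonempty) {σ : ℝ} (hσ : 0 < σ) (P : Measure (Euc d)) [IsProbabilityMeasure P] :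
    ∃ G ∈ probOn Θ, ∀ H ∈ probOn Θ,
      ∫⁻ x, ENNReal.ofReal (mixture σ H x / mixture σ G x) ∂P ≤ 1 := by
  have := isCompact_iff_compactSpace.1 hΘ
  have hmax (m : ℕ) := exists_maximizer_integral_log hΘ hΘne hσ
    (isCompact_closedBall (0 : Euc d) (m : ℝ)) (ae_restrict_closedBall_mem P m)
  choose G hG hGmax using hmax
  choose g hg using fun m => exists_extend_eq hΘ.measurableSet (hG m)
  obtain ⟨γ, hγ⟩ := exists_clusterPt_of_compactSpace (map g atTop)
  obtain ⟨U, hU, hlim⟩ := mapClusterPt_iff_ultrafilter.1 hγ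
  have hpos (K : ProbabilityMeasure Θ) (x : Euc d) : 0 < mixture σ (extend K) x :=
    have := (extend_mem_probOn hΘ.measurableSet K).1; mixture_pos hσ _ x
  refine ⟨extend γ, extend_mem_probOn hΘ.measurableSet γ, fun H hH => ?_⟩
  have hc := continuous_mixture_div_extend hΘ hσ hH
  have hnonneg (K : ProbabilityMeasure Θ) (x : Euc d) :
      0 ≤ mixture σ H x / mixture σ (extend K) x :=
    have := hH.1; (div_pos (mixture_pos hσ H x) (hpos K x)).le
  have hcx (K : ProbabilityMeasure Θ) :
      Continuous fun x => mixture σ H x / mixture σ (extend K) x :=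
    (continuous_mixture hΘ σ hH).div
      (continuous_mixture hΘ σ (extend_mem_probOn hΘ.measurableSet K)) fun x => (hpos K x).ne'
  refine lintegral_le_one_of_forall_closedBall (hcx γ) (hnonneg γ) fun m => ?_
  have hcm : Continuous fun K : ProbabilityMeasure Θ =>
      ∫ x in Metric.closedBall 0 (m : ℝ), mixture σ H x / mixture σ (extend K) x ∂P :=
    continuous_integral_of_ae_mem_compact (isCompact_closedBall (0 : Euc d) (m : ℝ))
    (ae_restrict_closedBall_mem P m) hc
  have hlim' : Tendsto (fun k => ∫ x in Metric.closedBall 0 (m : ℝ),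
      mixture σ H x / mixture σ (extend (g k)) x ∂P) U
      (𝓝 (∫ x in Metric.closedBall 0 (m : ℝ), mixture σ H x / mixture σ (extend γ) x ∂P)) :=
    (hcm.tendsto γ).comp hlim
  refine le_of_tendsto hlim' (hU ?_)
  filter_upwards [eventually_ge_atTop m] with k hk
  have hfo := integral_mixture_div_le_of_maximizer hΘ hσ
    (isCompact_closedBall (0 : Euc d) (k : ℝ)) (ae_restrict_closedBall_mem P k) (hG k)
    (hGmax k) hH
  have hint : Integrable (fun x => mixture σ H x / mixture σ (extend (g k)) x)
      (P.restrict (Metric.closedBall 0 (k : ℝ))) :=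
    integrable_of_ae_mem_compact (isCompact_closedBall 0 (k : ℝ))
      (ae_restrict_closedBall_mem P k) (hcx (g k))
  calc ∫ x in Metric.closedBall 0 (m : ℝ), mixture σ H x / mixture σ (extend (g k)) x ∂P
      ≤ ∫ x in Metric.closedBall 0 (k : ℝ), mixture σ H x / mixture σ (extend (g k)) x ∂P :=
        setIntegral_mono_set hint (ae_of_all _ (hnonneg (g k)))
          (Metric.closedBall_subset_closedBall (Nat.cast_le.2 hk)).eventuallyLE
    _ ≤ (P.restrict (Metric.closedBall 0 (k : ℝ))).real Set.univ := by rw [hg k]; exact hfo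
    _ ≤ 1 := by rw [measureReal_restrict_apply_univ]; exact measureReal_le_one

/-! ### Likelihood ratios of mean at most one -/

theorem integral_nonneg_iff_lintegral_neg_le {α : Type*} [MeasurableSpace α] {P : Measure α}
    {L : α → ℝ} (hL : Integrable L P) :
    0 ≤ ∫ x, L x ∂P ↔ ∫⁻ x, ENNReal.ofReal (-L x) ∂P ≤ ∫⁻ x, ENNReal.ofReal (L x) ∂P := by
  rw [integral_eq_lintegral_pos_part_sub_lintegral_neg_part hL, sub_nonneg]
  exact ENNReal.toReal_le_toReal hL.neg.lintegral_lt_top.ne hL.lintegral_lt_top.ne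

theorem integrable_of_lintegral_ofReal_ne_top {α : Type*} [MeasurableSpace α] {P : Measure α}
    {L : α → ℝ} (hm : AEStronglyMeasurable L P) (h1 : ∫⁻ x, ENNReal.ofReal (L x) ∂P ≠ ∞)
    (h2 : ∫⁻ x, ENNReal.ofReal (-L x) ∂P ≠ ∞) : Integrable L P := by
  refine ⟨hm, ?_⟩
  rw [hasFiniteIntegral_iff_norm]
  have h (x : α) : ENNReal.ofReal ‖L x‖ ≤ ENNReal.ofReal (L x) + ENNReal.ofReal (-L x) := by
    rcases le_total 0 (L x) with h | h
    · rw [Real.norm_of_nonneg h]; exact le_self_add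
    · rw [Real.norm_of_nonpos h]; exact le_add_self
  refine (lintegral_mono h).trans_lt ?_
  rw [lintegral_add_left' hm.aemeasurable.ennreal_ofReal]
  exact (ENNReal.add_ne_top.2 ⟨h1, h2⟩).lt_top

section Ratio

variable {α : Type*} [MeasurableSpace α] {P : Measure α} {t : α → ℝ}

theorem lintegral_ofReal_log_le_one (ht0 : ∀ x, 0 < t x)
    (ht : ∫⁻ x, ENNReal.ofReal (t x) ∂P ≤ 1) : ∫⁻ x, ENNReal.ofReal (Real.log (t x)) ∂P ≤ 1 :=
  (lintegral_mono fun x => ENNReal.ofReal_le_ofReal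
    ((Real.log_le_sub_one_of_pos (ht0 x)).trans (by linarith))).trans ht

theorem integrable_of_lintegral_le_one (htm : Measurable t)
    (ht0 : ∀ x, 0 < t x) (ht : ∫⁻ x, ENNReal.ofReal (t x) ∂P ≤ 1) : Integrable t P := by
  refine ⟨htm.aestronglyMeasurable, ?_⟩
  rw [hasFiniteIntegral_iff_ofReal (ae_of_all _ fun x => (ht0 x).le)]
  exact ht.trans_lt ENNReal.one_lt_top

theorem integral_sub_one_nonpos [IsProbabilityMeasure P] (htm : Measurable t)
    (ht0 : ∀ x, 0 < t x) (ht : ∫⁻ x, ENNReal.ofReal (t x) ∂P ≤ 1) :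
    ∫ x, (t x - 1) ∂P ≤ 0 := by
  have hti := integrable_of_lintegral_le_one htm ht0 ht
  rw [integral_sub hti (integrable_const _), integral_eq_lintegral_of_nonneg_ae
    (ae_of_all _ fun x => (ht0 x).le) htm.aestronglyMeasurable]
  have := ENNReal.toReal_mono ENNReal.one_ne_top ht
  simp only [ENNReal.toReal_one] at this
  simpa using this

theorem integral_log_nonpos [IsProbabilityMeasure P] (htm : Measurable t) (ht0 : ∀ x, 0 < t x)
    (ht : ∫⁻ x, ENNReal.ofReal (t x) ∂P ≤ 1) (hi : Integrable (fun x => Real.log (t x)) P) :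
    ∫ x, Real.log (t x) ∂P ≤ 0 :=
  (integral_mono hi ((integrable_of_lintegral_le_one htm ht0 ht).sub (integrable_const 1))
    fun x => Real.log_le_sub_one_of_pos (ht0 x)).trans (integral_sub_one_nonpos htm ht0 ht)

/-- Jensen's inequality for the logarithm, in a form that allows `∫ log t dP = -∞`. -/
theorem lintegral_log_le_lintegral_neg_log [IsProbabilityMeasure P] (htm : Measurable t)
    (ht0 : ∀ x, 0 < t x) (ht : ∫⁻ x, ENNReal.ofReal (t x) ∂P ≤ 1) :
    ∫⁻ x, ENNReal.ofReal (Real.log (t x)) ∂P ≤ ∫⁻ x, ENNReal.ofReal (-Real.log (t x)) ∂P := by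
  by_cases htop : ∫⁻ x, ENNReal.ofReal (-Real.log (t x)) ∂P = ∞
  · rw [htop]; exact le_top
  have hi : Integrable (fun x => Real.log (t x)) P :=
    integrable_of_lintegral_ofReal_ne_top htm.log.aestronglyMeasurable
      ((lintegral_ofReal_log_le_one ht0 ht).trans_lt ENNReal.one_lt_top).ne htop
  have h := (integral_nonneg_iff_lintegral_neg_le hi.neg).1 (by
    simp only [Pi.neg_apply]
    rw [integral_neg, neg_nonneg]
    exact integral_log_nonpos htm ht0 ht hi)
  simpa using h

/-- The equality case of Jensen's inequality. -/
theorem ae_eq_one_of_lintegral_neg_log_le [IsProbabilityMeasure P] (htm : Measurable t)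
    (ht0 : ∀ x, 0 < t x) (ht : ∫⁻ x, ENNReal.ofReal (t x) ∂P ≤ 1)
    (hlog : ∫⁻ x, ENNReal.ofReal (-Real.log (t x)) ∂P
      ≤ ∫⁻ x, ENNReal.ofReal (Real.log (t x)) ∂P) : ∀ᵐ x ∂P, t x = 1 := by
  have hfin := ((lintegral_ofReal_log_le_one ht0 ht).trans_lt ENNReal.one_lt_top).ne
  have hi : Integrable (fun x => Real.log (t x)) P :=
    integrable_of_lintegral_ofReal_ne_top htm.log.aestronglyMeasurable hfin
      (ne_top_of_le_ne_top hfin hlog)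
  have h0 := (integral_nonneg_iff_lintegral_neg_le hi).2 hlog
  have hti : Integrable (fun x => t x - 1) P :=
    (integrable_of_lintegral_le_one htm ht0 ht).sub (integrable_const 1)
  have hnonneg (x : α) : 0 ≤ t x - 1 - Real.log (t x) :=
    sub_nonneg.2 (Real.log_le_sub_one_of_pos (ht0 x))
  have hz : ∫ x, (t x - 1 - Real.log (t x)) ∂P = 0 := by
    refine le_antisymm ?_ (integral_nonneg hnonneg)
    rw [integral_sub hti hi]
    linarith [integral_sub_one_nonpos htm ht0 ht]
  filter_upwards [(integral_eq_zero_iff_of_nonneg hnonneg (hti.sub hi)).1 hz] with x hx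
  by_contra hne
  have h1 := Real.log_lt_sub_one_of_pos (ht0 x) hne
  simp only [Pi.zero_apply] at hx
  linarith

end Ratio

/-! ### Kullback-Leibler divergences of positive densities -/

theorem integrable_gaussianDensity {d : ℕ} {σ : ℝ} (hσ : 0 < σ) :
    Integrable (gaussianDensity σ : Euc d → ℝ) ∧ ∫ x : Euc d, gaussianDensity σ x = 1 := by
  have hb : 0 < (2 * σ ^ 2)⁻¹ := by positivity
  have hform : (gaussianDensity σ : Euc d → ℝ) = fun x =>
      (Real.sqrt (2 * Real.pi * σ ^ 2) ^ d)⁻¹ * Real.exp (-(2 * σ ^ 2)⁻¹ * ‖x‖ ^ 2) := by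
    funext x
    rw [gaussianDensity]
    congr 2
    ring
  have hval : ∫ x : Euc d, gaussianDensity σ x = 1 := by
    rw [hform, integral_const_mul, GaussianFourier.integral_rexp_neg_mul_sq_norm hb,
      finrank_euclideanSpace, Fintype.card_fin, Real.sqrt_eq_rpow,
      ← Real.rpow_natCast _ d, ← Real.rpow_mul (by positivity)]
    have h1 : Real.pi / (2 * σ ^ 2)⁻¹ = 2 * Real.pi * σ ^ 2 := by field_simp
    rw [h1, show (1 / 2 : ℝ) * d = d / 2 by ring]
    exact inv_mul_cancel₀ (by positivity)
  refine ⟨?_, hval⟩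
  by_contra h
  rw [integral_undef h] at hval
  exact zero_ne_one hval

theorem isDensity_mixture {d : ℕ} {Θ : Set (Euc d)} (hΘ : IsCompact Θ) {σ : ℝ} (hσ : 0 < σ)
    {G : Measure (Euc d)} (hG : G ∈ probOn Θ) : IsDensity (mixture σ G) := by
  have := hG.1
  refine ⟨(continuous_mixture hΘ σ hG).measurable, fun x => (mixture_pos hσ G x).le, ?_⟩
  have hφ := continuous_gaussianDensity (d := d) σ
  have h1 (x : Euc d) : ENNReal.ofReal (mixture σ G x)
      = ∫⁻ θ, ENNReal.ofReal (gaussianDensity σ (x - θ)) ∂G :=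
    ofReal_integral_eq_lintegral_ofReal (integrable_gaussianDensity_sub hσ G x)
      (ae_of_all _ fun θ => (gaussianDensity_pos hσ _).le)
  have hm : Measurable (Function.uncurry fun x θ : Euc d =>
      ENNReal.ofReal (gaussianDensity σ (x - θ))) :=
    (Continuous.measurable (by fun_prop)).ennreal_ofReal
  simp only [h1]
  rw [lintegral_lintegral_swap hm.aemeasurable]
  have h2 (θ : Euc d) : ∫⁻ x, ENNReal.ofReal (gaussianDensity σ (x - θ)) = 1 := by
    rw [lintegral_sub_right_eq_self (fun x => ENNReal.ofReal (gaussianDensity σ x)) θ,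
      ← ofReal_integral_eq_lintegral_ofReal (integrable_gaussianDensity hσ).1
        (ae_of_all _ fun θ => (gaussianDensity_pos hσ _).le), (integrable_gaussianDensity hσ).2,
      ENNReal.ofReal_one]
  simp [h2]

theorem IsDensity.isProbabilityMeasure {d : ℕ} {p : Euc d → ℝ} (hp : IsDensity p) :
    IsProbabilityMeasure (densityMeasure p) :=
  ⟨by rw [densityMeasure, withDensity_apply _ MeasurableSet.univ, setLIntegral_univ,
    hp.lintegral_eq_one]⟩

theorem densityMeasure_absolutelyContinuous_of_pos {d : ℕ} {p q : Euc d → ℝ} (hq : IsDensity q)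
    (hq0 : ∀ x, 0 < q x) : densityMeasure p ≪ densityMeasure q :=
  (withDensity_absolutelyContinuous _ _).trans
    (withDensity_absolutelyContinuous' hq.measurable.ennreal_ofReal.aemeasurable
      (ae_of_all _ fun x => (ENNReal.ofReal_pos.2 (hq0 x)).ne'))

theorem llr_densityMeasure {d : ℕ} {p q : Euc d → ℝ} (hp : IsDensity p) (hq : IsDensity q)
    (hq0 : ∀ x, 0 < q x) :
    llr (densityMeasure p) (densityMeasure q) =ᵐ[densityMeasure p]
      fun x => Real.log (p x / q x) := by
  have := hq.isProbabilityMeasure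
  have hm : Measurable fun x => ENNReal.ofReal (p x / q x) :=
    (hp.measurable.div hq.measurable).ennreal_ofReal
  have hpq : densityMeasure p
      = (densityMeasure q).withDensity fun x => ENNReal.ofReal (p x / q x) := by
    rw [densityMeasure, densityMeasure, ← withDensity_mul _ hq.measurable.ennreal_ofReal hm]
    congr 1
    funext x
    rw [Pi.mul_apply, ← ENNReal.ofReal_mul (hq0 x).le, mul_div_cancel₀ _ (hq0 x).ne']
  have h := Measure.rnDeriv_withDensity (densityMeasure q) hm
  rw [← hpq] at h
  filter_upwards [(densityMeasure_absolutelyContinuous_of_pos hq hq0).ae_le h] with x hx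
  rw [llr, hx, ENNReal.toReal_ofReal (div_nonneg (hp.nonneg x) (hq0 x).le)]

theorem KL_ne_top_iff {d : ℕ} {p q : Euc d → ℝ} (hp : IsDensity p) (hq : IsDensity q)
    (hq0 : ∀ x, 0 < q x) :
    KL p q ≠ ∞ ↔ Integrable (fun x => Real.log (p x / q x)) (densityMeasure p) := by
  rw [KL, klDiv_ne_top_iff, integrable_congr (llr_densityMeasure hp hq hq0)]
  exact and_iff_right (densityMeasure_absolutelyContinuous_of_pos hq hq0)

theorem toReal_KL {d : ℕ} {p q : Euc d → ℝ} (hp : IsDensity p) (hq : IsDensity q)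
    (hq0 : ∀ x, 0 < q x) :
    (KL p q).toReal = ∫ x, Real.log (p x / q x) ∂densityMeasure p := by
  have := hp.isProbabilityMeasure
  have := hq.isProbabilityMeasure
  rw [KL, toReal_klDiv_of_measure_eq (densityMeasure_absolutelyContinuous_of_pos hq hq0)
    (by simp), integral_congr_ae (llr_densityMeasure hp hq hq0)]

theorem ae_densityMeasure_pos {d : ℕ} {p : Euc d → ℝ} (hp : IsDensity p) :
    ∀ᵐ x ∂densityMeasure p, 0 < p x := by
  rw [densityMeasure, ae_withDensity_iff hp.measurable.ennreal_ofReal]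
  exact ae_of_all _ fun x hx => ENNReal.ofReal_pos.1 (pos_iff_ne_zero.2 hx)

/-- The negative part in `∫ p log (p / q)` is always finite. -/
theorem lintegral_neg_log_div_le_one {d : ℕ} {p q : Euc d → ℝ} (hp : IsDensity p)
    (hq : IsDensity q) (hq0 : ∀ x, 0 < q x) :
    ∫⁻ x, ENNReal.ofReal (-Real.log (p x / q x)) ∂densityMeasure p ≤ 1 := by
  have h1 : ∫⁻ x, ENNReal.ofReal (-Real.log (p x / q x)) ∂densityMeasure p
      ≤ ∫⁻ x, ENNReal.ofReal (q x / p x) ∂densityMeasure p := by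
    refine lintegral_mono_ae ?_
    filter_upwards [ae_densityMeasure_pos hp] with x hx
    rw [← Real.log_inv, inv_div]
    exact ENNReal.ofReal_le_ofReal
      ((Real.log_le_sub_one_of_pos (div_pos (hq0 x) hx)).trans (by linarith))
  have hm : Measurable fun x => ENNReal.ofReal (q x / p x) :=
    (hq.measurable.div hp.measurable).ennreal_ofReal
  refine h1.trans ?_
  rw [densityMeasure, lintegral_withDensity_eq_lintegral_mul _ hp.measurable.ennreal_ofReal hm,
    ← hq.lintegral_eq_one]
  refine lintegral_mono fun x => ?_
  rw [Pi.mul_apply, ← ENNReal.ofReal_mul (hp.nonneg x)]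
  refine ENNReal.ofReal_le_ofReal ?_
  rcases (hp.nonneg x).eq_or_lt with h | h
  · rw [← h, zero_mul]; exact (hq0 x).le
  · rw [mul_div_cancel₀ _ h.ne']

/-- If the ratio `r / q` has mean at most one under `p`, then `q` is at least as close to `p` as
`r`. -/
theorem KL_le_KL {d : ℕ} {p q r : Euc d → ℝ} (hp : IsDensity p) (hq : IsDensity q)
    (hr : IsDensity r) (hq0 : ∀ x, 0 < q x) (hr0 : ∀ x, 0 < r x)
    (h : ∫⁻ x, ENNReal.ofReal (r x / q x) ∂densityMeasure p ≤ 1) : KL p q ≤ KL p r := by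
  have := hp.isProbabilityMeasure
  by_cases htop : KL p r = ∞
  · rw [htop]; exact le_top
  have hri := (KL_ne_top_iff hp hr hr0).1 htop
  have ht0 (x : Euc d) : 0 < r x / q x := div_pos (hr0 x) (hq0 x)
  have htm : Measurable fun x => r x / q x := hr.measurable.div hq.measurable
  have hsplit : ∀ᵐ x ∂densityMeasure p,
      Real.log (p x / q x) = Real.log (p x / r x) + Real.log (r x / q x) := by
    filter_upwards [ae_densityMeasure_pos hp] with x hx
    rw [← Real.log_mul (div_pos hx (hr0 x)).ne' (ht0 x).ne', div_mul_div_cancel₀ (hr0 x).ne']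
  have hneg : ∫⁻ x, ENNReal.ofReal (-Real.log (r x / q x)) ∂densityMeasure p ≠ ∞ := by
    have hle : ∫⁻ x, ENNReal.ofReal (-Real.log (r x / q x)) ∂densityMeasure p
        ≤ ∫⁻ x, (ENNReal.ofReal (-Real.log (p x / q x))
          + ENNReal.ofReal (Real.log (p x / r x))) ∂densityMeasure p := by
      refine lintegral_mono_ae ?_
      filter_upwards [hsplit] with x hx
      refine le_trans (ENNReal.ofReal_le_ofReal ?_) ENNReal.ofReal_add_le
      linarith
    have hm : Measurable fun x => ENNReal.ofReal (Real.log (p x / r x)) :=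
      (hp.measurable.div hr.measurable).log.ennreal_ofReal
    rw [lintegral_add_right _ hm] at hle
    refine ne_top_of_le_ne_top (ENNReal.add_ne_top.2 ⟨?_, hri.lintegral_lt_top.ne⟩) hle
    exact ne_top_of_le_ne_top ENNReal.one_ne_top (lintegral_neg_log_div_le_one hp hq hq0)
  have hti : Integrable (fun x => Real.log (r x / q x)) (densityMeasure p) :=
    integrable_of_lintegral_ofReal_ne_top htm.log.aestronglyMeasurable
      (ne_top_of_le_ne_top ENNReal.one_ne_top (lintegral_ofReal_log_le_one ht0 h)) hneg
  have hqi : Integrable (fun x => Real.log (p x / q x)) (densityMeasure p) :=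
    (hri.add hti).congr (hsplit.mono fun x hx => hx.symm)
  rw [← ENNReal.toReal_le_toReal ((KL_ne_top_iff hp hq hq0).2 hqi) htop,
    toReal_KL hp hq hq0, toReal_KL hp hr hr0, integral_congr_ae hsplit, integral_add hri hti]
  linarith [integral_log_nonpos htm ht0 h hti]

/-- If `r / q` has mean at most one under `p` and yet `r` is at least as close to `p` as `q`, at a
finite divergence, then `r` and `q` agree `p`-almost everywhere. -/
theorem ae_eq_of_KL_le_KL {d : ℕ} {p q r : Euc d → ℝ} (hp : IsDensity p) (hq : IsDensity q)
    (hr : IsDensity r) (hq0 : ∀ x, 0 < q x) (hr0 : ∀ x, 0 < r x)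
    (h : ∫⁻ x, ENNReal.ofReal (r x / q x) ∂densityMeasure p ≤ 1) (hle : KL p r ≤ KL p q)
    (hfin : KL p q ≠ ∞) : ∀ᵐ x ∂densityMeasure p, r x / q x = 1 := by
  have := hp.isProbabilityMeasure
  have hrfin := ne_top_of_le_ne_top hfin hle
  have hqi := (KL_ne_top_iff hp hq hq0).1 hfin
  have hri := (KL_ne_top_iff hp hr hr0).1 hrfin
  have ht0 (x : Euc d) : 0 < r x / q x := div_pos (hr0 x) (hq0 x)
  have htm : Measurable fun x => r x / q x := hr.measurable.div hq.measurable
  have hsplit : ∀ᵐ x ∂densityMeasure p,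
      Real.log (p x / q x) - Real.log (p x / r x) = Real.log (r x / q x) := by
    filter_upwards [ae_densityMeasure_pos hp] with x hx
    rw [← Real.log_div (div_pos hx (hq0 x)).ne' (div_pos hx (hr0 x)).ne']
    congr 1
    have h1 := (hq0 x).ne'
    have h2 := (hr0 x).ne'
    field_simp
  refine ae_eq_one_of_lintegral_neg_log_le htm ht0 h
    ((integral_nonneg_iff_lintegral_neg_le ((hqi.sub hri).congr hsplit)).1 ?_)
  rw [← integral_congr_ae hsplit, integral_sub hqi hri, ← toReal_KL hp hq hq0,
    ← toReal_KL hp hr hr0]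
  exact sub_nonneg.2 (ENNReal.toReal_mono hfin hle)

/-- The set where the two mixtures agree has full measure under `p`, so it is not Lebesgue null. -/
theorem eq_of_ae_mixture_div_eq_one {d : ℕ} {Θ : Set (Euc d)} (hΘ : IsCompact Θ) {σ : ℝ}
    (hσ : 0 < σ) {p : Euc d → ℝ} (hp : IsDensity p) {G H : Measure (Euc d)} (hG : G ∈ probOn Θ)
    (hH : H ∈ probOn Θ) (h : ∀ᵐ x ∂densityMeasure p, mixture σ G x / mixture σ H x = 1) :
    G = H := by
  have := hp.isProbabilityMeasure
  have := hH.1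
  refine eq_of_mixture_eq_on hΘ hσ hG hH fun h0 => ?_
  have h1 : ∀ᵐ x ∂densityMeasure p, False := by
    have h2 : ∀ᵐ x ∂densityMeasure p, ¬ mixture σ G x = mixture σ H x := by
      refine (withDensity_absolutelyContinuous _ _).ae_le (ae_iff.2 ?_)
      simpa using h0
    filter_upwards [h, h2] with x hx1 hx2
    exact hx2 ((div_eq_one_iff_eq (mixture_pos hσ H x).ne').1 hx1)
  exact h1.exists.choose_spec

/-! ### Couplings and weak convergence -/

/-- A coupling adapted to a partition of unity `χ`. If `P` gives each piece of the partition at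
least the share `w` of its mass under `Q`, then the share `w` of the mass can be transported within
the pieces, and only the remaining share `δ` has to be transported further. -/
theorem exists_coupling_of_partition {X J : Type*} [MeasurableSpace X] [Fintype J]
    {P Q : Measure X} [IsProbabilityMeasure P] [IsProbabilityMeasure Q] {χ : J → X → ℝ≥0∞}
    (hχ : ∀ j, Measurable (χ j)) (hsum : ∀ x, ∑ j, χ j x = 1) {w δ : ℝ≥0∞} (hw : w + δ = 1)
    (hle : ∀ j, w * ∫⁻ x, χ j x ∂Q ≤ ∫⁻ x, χ j x ∂P) {c : X × X → ℝ≥0∞} (hc : Measurable c)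
    {e D : ℝ≥0∞} (hD : ∀ z, c z ≤ D)
    (he : ∀ j x y, χ j x ≠ 0 → χ j y ≠ 0 → c (x, y) ≤ e) :
    ∃ γ : Measure (X × X), γ.map Prod.fst = P ∧ γ.map Prod.snd = Q ∧
      ∫⁻ z, c z ∂γ ≤ e + D * δ := by
  set p : J → ℝ≥0∞ := fun j => ∫⁻ x, χ j x ∂P with hp
  set q : J → ℝ≥0∞ := fun j => ∫⁻ x, χ j x ∂Q with hq
  have hχ1 (j : J) (x : X) : χ j x ≤ 1 :=
    (Finset.single_le_sum (fun i _ => zero_le) (Finset.mem_univ j)).trans (hsum x).le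
  have hp1 (j : J) : p j ≤ 1 := (lintegral_mono (hχ1 j)).trans (by simp)
  have hq1 (j : J) : q j ≤ 1 := (lintegral_mono (hχ1 j)).trans (by simp)
  have hptop (j : J) : p j ≠ ∞ := ne_top_of_le_ne_top ENNReal.one_ne_top (hp1 j)
  have hqtop (j : J) : q j ≠ ∞ := ne_top_of_le_ne_top ENNReal.one_ne_top (hq1 j)
  have hqsum : ∑ j, q j = 1 := by
    rw [hq, ← lintegral_finsetSum _ fun j _ => hχ j]
    simp [hsum]
  set Pj : J → Measure X := fun j => P.withDensity (χ j) with hPj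
  set Qj : J → Measure X := fun j => Q.withDensity (χ j) with hQj
  have hPu (j : J) : Pj j Set.univ = p j := by simp [hPj, hp]
  have hQu (j : J) : Qj j Set.univ = q j := by simp [hQj, hq]
  have hPfin (j : J) : IsFiniteMeasure (Pj j) := ⟨by rw [hPu]; exact (hptop j).lt_top⟩
  have hQfin (j : J) : IsFiniteMeasure (Qj j) := ⟨by rw [hQu]; exact (hqtop j).lt_top⟩
  -- a piece that is null for `P` either is null for `Q` or `w = 0`, so that `0⁻¹ * 0` is harmless
  have hcancel (j : J) (a : ℝ≥0∞) (ha : q j = 0 → a = 0) : w * (p j)⁻¹ * p j * a = w * a := by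
    by_cases hpj : p j = 0
    · have h0 : w * q j = 0 := le_antisymm ((hle j).trans hpj.le) zero_le
      rcases mul_eq_zero.1 h0 with h | h
      · simp [h]
      · simp [ha h]
    · rw [mul_assoc w, ENNReal.inv_mul_cancel hpj (hptop j), mul_one]
  set s : X → ℝ≥0∞ := fun x => ∑ j, w * (p j)⁻¹ * q j * χ j x with hs
  have hsm : Measurable s := Finset.measurable_sum _ fun j _ => (hχ j).const_mul _
  have hs1 (x : X) : s x ≤ 1 := by
    rw [← hsum x]
    refine Finset.sum_le_sum fun j _ => mul_le_of_le_one_left zero_le ?_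
    rw [mul_right_comm, ← div_eq_mul_inv]
    exact ENNReal.div_le_of_le_mul (by rw [one_mul]; exact hle j)
  set R : Measure X := P.withDensity fun x => 1 - s x with hR
  have hsint (A : Set X) : ∫⁻ x in A, s x ∂P = ∑ j, w * (p j)⁻¹ * q j * Pj j A := by
    rw [hs, lintegral_finsetSum _ fun j _ => (hχ j).const_mul _]
    refine Finset.sum_congr rfl fun j _ => ?_
    rw [lintegral_const_mul _ (hχ j), hPj, withDensity_apply' _ A]
  have hsR {A : Set X} (hA : MeasurableSet A) : ∫⁻ x in A, s x ∂P + R A = P A := by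
    rw [hR, withDensity_apply _ hA, ← lintegral_add_left hsm]
    simp only [add_tsub_cancel_of_le (hs1 _), setLIntegral_const, one_mul]
  have hsu : ∫⁻ x in Set.univ, s x ∂P = w := by
    rw [hsint]
    have h (j : J) : w * (p j)⁻¹ * q j * Pj j Set.univ = w * q j := by
      rw [hPu, mul_right_comm, hcancel j _ id]
    simp only [h, ← Finset.mul_sum, hqsum, mul_one]
  have hwtop : w ≠ ∞ := ne_top_of_le_ne_top ENNReal.one_ne_top (hw ▸ le_self_add)
  have hRu : R Set.univ = δ := by
    have h := hsR MeasurableSet.univ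
    rw [hsu, measure_univ (μ := P), ← hw] at h
    exact (ENNReal.add_right_inj hwtop).1 h
  have hRfin : IsFiniteMeasure R :=
    ⟨by rw [hRu]; exact (le_add_self.trans hw.le).trans_lt ENNReal.one_lt_top⟩
  -- the first term couples within the pieces; the remainder `R` of `P` is coupled independently
  refine ⟨∑ j, (w * (p j)⁻¹) • (Pj j).prod (Qj j) + R.prod Q, ?_, ?_, ?_⟩
  · ext A hA
    rw [Measure.map_apply measurable_fst hA, ← Set.prod_univ]
    simp only [Measure.add_apply, Measure.finsetSum_apply, Measure.smul_apply, Measure.prod_prod,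
      measure_univ, hQu, smul_eq_mul, mul_one]
    rw [← hsR hA, hsint]
    congr 1
    exact Finset.sum_congr rfl fun j _ => by ring
  · ext A hA
    rw [Measure.map_apply measurable_snd hA, ← Set.univ_prod]
    simp only [Measure.add_apply, Measure.finsetSum_apply, Measure.smul_apply, Measure.prod_prod,
      hPu, smul_eq_mul, hRu, ← mul_assoc]
    have h (j : J) : w * (p j)⁻¹ * p j * Qj j A = w * Qj j A := by
      refine hcancel j _ fun h0 => ?_
      exact measure_mono_null (Set.subset_univ A) ((hQu j).trans h0)
    have hQA : ∑ j, Qj j A = Q A := by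
      simp only [hQj, withDensity_apply _ hA]
      rw [← lintegral_finsetSum _ fun j _ => hχ j]
      simp [hsum]
    simp only [h, ← Finset.mul_sum, hQA]
    rw [← add_mul, hw, one_mul]
  · rw [lintegral_add_measure, lintegral_finsetSum_measure]
    refine add_le_add ?_ ?_
    · have h (j : J) : ∫⁻ z, c z ∂((w * (p j)⁻¹) • (Pj j).prod (Qj j)) ≤ w * q j * e := by
        have hP0 : ∀ᵐ x ∂Pj j, χ j x ≠ 0 := by
          rw [hPj, ae_withDensity_iff (hχ j)]
          exact ae_of_all _ fun x hx => hx
        have hQ0 : ∀ᵐ x ∂Qj j, χ j x ≠ 0 := by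
          rw [hQj, ae_withDensity_iff (hχ j)]
          exact ae_of_all _ fun x hx => hx
        have h1 : ∫⁻ z, c z ∂(Pj j).prod (Qj j) ≤ e * q j * p j := by
          rw [lintegral_prod _ hc.aemeasurable, ← hPu j, ← lintegral_const]
          refine lintegral_mono_ae ?_
          filter_upwards [hP0] with x hx
          rw [← hQu j, ← lintegral_const]
          refine lintegral_mono_ae ?_
          filter_upwards [hQ0] with y hy using he j x y hx hy
        rw [lintegral_smul_measure, smul_eq_mul]
        calc w * (p j)⁻¹ * ∫⁻ z, c z ∂(Pj j).prod (Qj j)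
            ≤ w * (p j)⁻¹ * (e * q j * p j) := by gcongr
          _ = w * (p j)⁻¹ * p j * q j * e := by ring
          _ = w * q j * e := by rw [hcancel j _ id]
      refine (Finset.sum_le_sum fun j _ => h j).trans ?_
      rw [← Finset.sum_mul, ← Finset.mul_sum, hqsum, mul_one]
      exact mul_le_of_le_one_left zero_le (le_self_add.trans hw.le)
    · refine (lintegral_mono hD).trans ?_
      rw [lintegral_const, ← Set.univ_prod_univ, Measure.prod_prod, hRu,
        measure_univ (μ := Q), mul_one]

open scoped NNReal in
/-- Fine continuous partitions of unity on a compact metric space. -/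
theorem exists_partition_of_unity {X : Type*} [PseudoMetricSpace X] [CompactSpace X] {ε : ℝ}
    (hε : 0 < ε) : ∃ (t : Finset X) (χ : t → X → ℝ≥0), (∀ j, Continuous (χ j)) ∧
      (∀ x, ∑ j, χ j x = 1) ∧ ∀ j x y, χ j x ≠ 0 → χ j y ≠ 0 → dist x y < 2 * ε := by
  obtain ⟨t, -, htfin, ht⟩ := finite_cover_balls_of_compact (isCompact_univ (X := X)) hε
  set f : X → X → ℝ≥0 := fun a x => (ε - dist x a).toNNReal with hf
  have hfc (a : X) : Continuous (f a) := by fun_prop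
  have hf0 {a x : X} (h : f a x ≠ 0) : dist x a < ε := by
    by_contra h'
    exact h (Real.toNNReal_eq_zero.2 (by linarith))
  set F : X → ℝ≥0 := fun x => ∑ a : htfin.toFinset, f a x with hF
  have hFc : Continuous F := continuous_finsetSum _ fun a _ => hfc a
  have hFpos (x : X) : F x ≠ 0 := by
    obtain ⟨a, hat, hxa⟩ := Set.mem_iUnion₂.1 (ht (Set.mem_univ x))
    refine (lt_of_lt_of_le (Real.toNNReal_pos.2 (sub_pos.2 hxa))
      (Finset.single_le_sum (f := fun a : htfin.toFinset => f a x) (fun i _ => zero_le)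
        (Finset.mem_univ ⟨a, htfin.mem_toFinset.2 hat⟩))).ne'
  refine ⟨htfin.toFinset, fun a x => f a x / F x, fun a => (hfc a).div hFc hFpos, fun x => ?_,
    fun a x y hx hy => ?_⟩
  · rw [← Finset.sum_div]
    exact div_self (hFpos x)
  · have h1 := hf0 (div_ne_zero_iff.1 hx).1
    have h2 := hf0 (div_ne_zero_iff.1 hy).1
    linarith [dist_triangle_right x y a]

/-- Weak convergence on a compact metric space is convergence in transport cost. -/
theorem eventually_exists_coupling {X ι : Type*} [PseudoMetricSpace X] [CompactSpace X]
    [MeasurableSpace X] [BorelSpace X] {l : Filter ι} {P : ι → ProbabilityMeasure X}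
    {Q : ProbabilityMeasure X} (h : Tendsto P l (𝓝 Q)) {r : ℝ} (hr : 0 < r) {η : ℝ≥0∞}
    (hη : η ≠ 0) : ∀ᶠ i in l, ∃ γ : Measure (X × X), γ.map Prod.fst = P i ∧ γ.map Prod.snd = Q ∧
      ∫⁻ z, edist z.1 z.2 ^ r ∂γ ≤ η := by
  have hη2 : η / 2 ≠ 0 := by simpa using hη
  obtain ⟨C, hC⟩ := Metric.isBounded_iff.1 (isCompact_univ (X := X)).isBounded
  set D : ℝ≥0∞ := ENNReal.ofReal C ^ r with hDdef
  have hDtop : D ≠ ∞ := ENNReal.rpow_ne_top_of_nonneg hr.le ENNReal.ofReal_ne_top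
  have hD (z : X × X) : edist z.1 z.2 ^ r ≤ D := by
    refine ENNReal.rpow_le_rpow ?_ hr.le
    rw [edist_dist]
    exact ENNReal.ofReal_le_ofReal (hC (Set.mem_univ _) (Set.mem_univ _))
  set δ : ℝ≥0∞ := min 1 (η / 2 / D) with hδ
  have hδ0 : δ ≠ 0 := by
    rw [hδ]
    refine (lt_min one_pos (ENNReal.div_pos hη2 hDtop)).ne'
  -- the share transported further costs at most `D * δ ≤ η / 2`
  have hw : 1 - δ + δ = 1 := tsub_add_cancel_of_le (min_le_left _ _)
  have hpos : 0 < (η / 2) ^ (1 / r) := ENNReal.rpow_pos_of_nonneg (pos_iff_ne_zero.2 hη2)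
    (by positivity)
  obtain ⟨ε, hε0, hε⟩ := ENNReal.lt_iff_exists_nnreal_btwn.1 hpos
  have hε0' : (0 : ℝ) < ε / 2 := half_pos (NNReal.coe_pos.2 (ENNReal.coe_pos.1 hε0))
  obtain ⟨t, χ, hχc, hχsum, hχd⟩ := exists_partition_of_unity (X := X) hε0'
  have hev : ∀ᶠ i in l, ∀ j, (1 - δ) * ∫⁻ x, χ j x ∂(Q : Measure X)
      ≤ ∫⁻ x, χ j x ∂(P i : Measure X) := by
    refine eventually_all.2 fun j => ?_
    have hlim := (ProbabilityMeasure.tendsto_iff_forall_lintegral_tendsto.1 h)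
      (BoundedContinuousFunction.mkOfCompact ⟨χ j, hχc j⟩)
    simp only [BoundedContinuousFunction.mkOfCompact_apply, ContinuousMap.coe_mk] at hlim
    by_cases h0 : ∫⁻ x, χ j x ∂(Q : Measure X) = 0
    · simp [h0]
    have htop : ∫⁻ x, χ j x ∂(Q : Measure X) ≠ ∞ := by
      refine ne_top_of_le_ne_top ENNReal.one_ne_top
        ((lintegral_mono (g := fun _ => 1) fun x => ?_).trans (by simp))
      rw [ENNReal.coe_le_one_iff, ← hχsum x]
      exact Finset.single_le_sum (f := fun j => χ j x) (fun i _ => zero_le) (Finset.mem_univ j)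
    have hlt : (1 - δ) * ∫⁻ x, χ j x ∂(Q : Measure X) < ∫⁻ x, χ j x ∂(Q : Measure X) := by
      conv_rhs => rw [← one_mul (∫⁻ x, χ j x ∂(Q : Measure X))]
      exact ENNReal.mul_lt_mul_left h0 htop
        (ENNReal.sub_lt_self ENNReal.one_ne_top one_ne_zero hδ0)
    exact (hlim.eventually (lt_mem_nhds hlt)).mono fun i hi => hi.le
  have hnear (j : t) (x y : X) (hx : (χ j x : ℝ≥0∞) ≠ 0) (hy : (χ j y : ℝ≥0∞) ≠ 0) :
      edist x y ^ r ≤ η / 2 := by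
    have hd := hχd j x y (ENNReal.coe_ne_zero.1 hx) (ENNReal.coe_ne_zero.1 hy)
    have he : edist x y ≤ (η / 2) ^ (1 / r) := by
      refine le_trans ?_ hε.le
      rw [edist_nndist, ENNReal.coe_le_coe, ← NNReal.coe_le_coe, coe_nndist]
      linarith
    calc edist x y ^ r ≤ ((η / 2) ^ (1 / r)) ^ r := ENNReal.rpow_le_rpow he hr.le
      _ = η / 2 := by rw [← ENNReal.rpow_mul, one_div_mul_cancel hr.ne', ENNReal.rpow_one]
  filter_upwards [hev] with i hi
  obtain ⟨γ, h1, h2, h3⟩ := exists_coupling_of_partition (P := (P i : Measure X))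
    (Q := (Q : Measure X)) (χ := fun j x => (χ j x : ℝ≥0∞))
    (fun j => (hχc j).measurable.coe_nnreal_ennreal)
    (fun x => by rw [← ENNReal.ofNNReal_finsetSum, hχsum, ENNReal.coe_one]) hw hi
    (c := fun z => edist z.1 z.2 ^ r) (by fun_prop) hD hnear
  refine ⟨γ, h1, h2, h3.trans ?_⟩
  calc η / 2 + D * δ ≤ η / 2 + D * (η / 2 / D) := by gcongr; exact min_le_right _ _
    _ ≤ η / 2 + η / 2 := by gcongr; exact ENNReal.mul_div_le
    _ = η := ENNReal.add_halves η

theorem tendsto_wasserstein_extend {d : ℕ} {Θ : Set (Euc d)} [CompactSpace Θ] {ι : Type*}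
    {l : Filter ι} {P : ι → ProbabilityMeasure Θ} {Q : ProbabilityMeasure Θ}
    (h : Tendsto P l (𝓝 Q)) {r : ℝ} (hr : 0 < r) :
    Tendsto (fun i => wasserstein r (extend (P i)) (extend Q)) l (𝓝 0) := by
  refine ENNReal.tendsto_nhds_zero.2 fun η hη => ?_
  have hηr : η ^ r ≠ 0 := (ENNReal.rpow_pos_of_nonneg hη hr.le).ne'
  filter_upwards [eventually_exists_coupling h hr hηr] with i hi
  obtain ⟨γ, h1, h2, h3⟩ := hi
  have hm : Measurable (Prod.map Subtype.val Subtype.val : Θ × Θ → Euc d × Euc d) :=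
    measurable_subtype_coe.prodMap measurable_subtype_coe
  have hmem : γ.map (Prod.map Subtype.val Subtype.val) ∈ couplings (extend (P i)) (extend Q) := by
    constructor
    · rw [Measure.map_map measurable_fst hm, extend, ← h1,
        Measure.map_map measurable_subtype_coe measurable_fst]
      rfl
    · rw [Measure.map_map measurable_snd hm, extend, ← h2,
        Measure.map_map measurable_subtype_coe measurable_snd]
      rfl
  have hcost : ⨅ γ ∈ couplings (extend (P i)) (extend Q), ∫⁻ z, edist z.1 z.2 ^ r ∂γ ≤ η ^ r := by
    refine (iInf₂_le _ hmem).trans ?_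
    rw [lintegral_map (by fun_prop) hm]
    exact h3
  calc wasserstein r (extend (P i)) (extend Q) ≤ (η ^ r) ^ (1 / r) :=
        ENNReal.rpow_le_rpow hcost (by positivity)
    _ = η := by rw [← ENNReal.rpow_mul, mul_one_div_cancel hr.ne', ENNReal.rpow_one]

/-! ### Consistency of the maximum likelihood estimator -/

theorem extend_injective {d : ℕ} {Θ : Set (Euc d)} (hΘ : MeasurableSet Θ) :
    Function.Injective (extend : ProbabilityMeasure Θ → Measure (Euc d)) := by
  intro g h hgh
  refine Subtype.ext ?_
  have hemb := MeasurableEmbedding.subtype_coe hΘ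
  calc (g : Measure Θ) = (extend g).comap Subtype.val := (hemb.comap_map _).symm
    _ = (extend h).comap Subtype.val := by rw [hgh]
    _ = h := hemb.comap_map _

/-- The strong law of large numbers, uniformly over a compact parameter space `S` and truncated to
balls: it is the strong law in the Banach space `C(S, ℝ)`. -/
theorem ae_tendsto_average_indicator_closedBall {d : ℕ} {S Ω : Type*} [TopologicalSpace S]
    [CompactSpace S] [MeasurableSpace Ω] (μ : Measure Ω) {P : Measure (Euc d)} [IsFiniteMeasure P]
    {Y : ℕ → Ω → Euc d} (hY : ∀ i, Measurable (Y i)) (hind : iIndepFun Y μ)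
    (hP : ∀ i, μ.map (Y i) = P) {F : Euc d → C(S, ℝ)} (hF : Continuous F) :
    ∀ᵐ ω ∂μ, ∀ k : ℕ, Tendsto
      (fun n : ℕ => (n : ℝ)⁻¹ • ∑ i ∈ Finset.range n,
        (Metric.closedBall 0 (k : ℝ)).indicator F (Y i ω)) atTop
      (𝓝 (∫ x in Metric.closedBall 0 (k : ℝ), F x ∂P)) := by
  let _ : MeasurableSpace C(S, ℝ) := borel _
  have : BorelSpace C(S, ℝ) := ⟨rfl⟩
  refine ae_all_iff.2 fun k => ?_
  have hB : MeasurableSet (Metric.closedBall (0 : Euc d) (k : ℝ)) :=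
    Metric.isClosed_closedBall.measurableSet
  have hm : Measurable ((Metric.closedBall 0 (k : ℝ)).indicator F) := hF.measurable.indicator hB
  have hintP : Integrable ((Metric.closedBall 0 (k : ℝ)).indicator F) P :=
    (integrable_indicator_iff hB).2 (integrable_of_ae_mem_compact
      (isCompact_closedBall 0 (k : ℝ)) (ae_restrict_closedBall_mem P k) hF)
  have hval : ∫ ω, (Metric.closedBall 0 (k : ℝ)).indicator F (Y 0 ω) ∂μ
      = ∫ x in Metric.closedBall 0 (k : ℝ), F x ∂P := by
    rw [← integral_indicator hB, ← hP 0]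
    refine (integral_map (hY 0).aemeasurable ?_).symm
    rw [hP 0]
    exact hintP.aestronglyMeasurable
  rw [← hval]
  refine strong_law_ae (fun i ω => (Metric.closedBall 0 (k : ℝ)).indicator F (Y i ω)) ?_ ?_ ?_
  · have hint0 : Integrable ((Metric.closedBall 0 (k : ℝ)).indicator F) (μ.map (Y 0)) := by
      rw [hP 0]
      exact hintP
    exact hint0.comp_measurable (hY 0)
  · exact fun i j hij => (hind.indepFun hij).comp hm hm
  · intro i
    have hid : IdentDistrib (Y i) (Y 0) μ μ :=
      ⟨(hY i).aemeasurable, (hY 0).aemeasurable, by rw [hP i, hP 0]⟩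
    exact hid.comp hm

/-- Two mixing measures, each of which satisfies the first order condition against the other, are
equal. -/
theorem eq_of_lintegral_mixture_div_le_one {d : ℕ} {Θ : Set (Euc d)} (hΘ : IsCompact Θ) {σ : ℝ}
    (hσ : 0 < σ) {p : Euc d → ℝ} (hp : IsDensity p) {G H : Measure (Euc d)} (hG : G ∈ probOn Θ)
    (hH : H ∈ probOn Θ)
    (h1 : ∫⁻ x, ENNReal.ofReal (mixture σ G x / mixture σ H x) ∂densityMeasure p ≤ 1)
    (h2 : ∫⁻ x, ENNReal.ofReal (mixture σ H x / mixture σ G x) ∂densityMeasure p ≤ 1) :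
    G = H := by
  have := hp.isProbabilityMeasure
  have := hG.1
  have := hH.1
  have hGm := (continuous_mixture hΘ σ hG).measurable
  have hHm := (continuous_mixture hΘ σ hH).measurable
  have h3 := lintegral_log_le_lintegral_neg_log (hHm.div hGm)
    (fun x => div_pos (mixture_pos hσ H x) (mixture_pos hσ G x)) h2
  refine eq_of_ae_mixture_div_eq_one hΘ hσ hp hG hH (ae_eq_one_of_lintegral_neg_log_le
    (hGm.div hHm) (fun x => div_pos (mixture_pos hσ G x) (mixture_pos hσ H x)) h1 ?_)
  simp only [Pi.div_apply, ← Real.log_inv, inv_div] at h3 ⊢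
  exact h3

/-- The estimators converge weakly: every cluster point of them satisfies the first order condition
against the projection, because the estimators do so for the empirical measure. -/
theorem ae_tendsto_of_isNPMLE {d : ℕ} {Θ : Set (Euc d)} (hΘ : IsCompact Θ) {σ : ℝ} (hσ : 0 < σ)
    {p : Euc d → ℝ} (hp : IsDensity p) {γ : ProbabilityMeasure Θ}
    (hγ : ∀ H ∈ probOn Θ,
      ∫⁻ x, ENNReal.ofReal (mixture σ H x / mixture σ (extend γ) x) ∂densityMeasure p ≤ 1)
    {Ω : Type*} [MeasurableSpace Ω] (μ : Measure Ω) {Y : ℕ → Ω → Euc d}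
    (hY : ∀ i, Measurable (Y i)) (hind : iIndepFun Y μ)
    (hP : ∀ i, μ.map (Y i) = densityMeasure p) :
    ∀ᵐ ω ∂μ, ∀ g : ℕ → ProbabilityMeasure Θ,
      (∀ n, IsNPMLE Θ σ (fun i => Y i ω) n (extend (g n))) → Tendsto g atTop (𝓝 γ) := by
  have := hp.isProbabilityMeasure
  have := isCompact_iff_compactSpace.1 hΘ
  have hmem (K : ProbabilityMeasure Θ) := extend_mem_probOn hΘ.measurableSet K
  have hpos (K : ProbabilityMeasure Θ) (x : Euc d) : 0 < mixture σ (extend K) x :=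
    have := (hmem K).1; mixture_pos hσ _ x
  let F : C(Euc d × ProbabilityMeasure Θ, ℝ) :=
    ⟨fun q => mixture σ (extend γ) q.1 / mixture σ (extend q.2) q.1,
      continuous_mixture_div_extend hΘ hσ (hmem γ)⟩
  have hFapply (x : Euc d) (K : ProbabilityMeasure Θ) :
      F.curry x K = mixture σ (extend γ) x / mixture σ (extend K) x := rfl
  have hFnonneg (x : Euc d) (K : ProbabilityMeasure Θ) : 0 ≤ F.curry x K :=
    (div_pos (hpos γ x) (hpos K x)).le
  filter_upwards [ae_tendsto_average_indicator_closedBall μ hY hind hP F.curry.continuous]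
    with ω hω g hg
  refine isCompact_univ.le_nhds_of_unique_clusterPt univ_mem fun κ _ hκ => ?_
  obtain ⟨U, hU, hlim⟩ := mapClusterPt_iff_ultrafilter.1 hκ
  refine extend_injective hΘ.measurableSet (eq_of_lintegral_mixture_div_le_one hΘ hσ hp (hmem κ)
    (hmem γ) (hγ _ (hmem κ)) ?_)
  have hcx : Continuous fun x => mixture σ (extend γ) x / mixture σ (extend κ) x :=
    (continuous_mixture hΘ σ (hmem γ)).div (continuous_mixture hΘ σ (hmem κ))
      fun x => (hpos κ x).ne'
  refine lintegral_le_one_of_forall_closedBall hcx (fun x => hFnonneg x κ) fun k => ?_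
  have hint : Integrable (fun x => F.curry x)
      ((densityMeasure p).restrict (Metric.closedBall 0 (k : ℝ))) :=
    integrable_of_ae_mem_compact (isCompact_closedBall 0 (k : ℝ))
      (ae_restrict_closedBall_mem _ k) F.curry.continuous
  have hval : (∫ x in Metric.closedBall 0 (k : ℝ), F.curry x ∂densityMeasure p) κ
      = ∫ x in Metric.closedBall 0 (k : ℝ),
        mixture σ (extend γ) x / mixture σ (extend κ) x ∂densityMeasure p :=
    ContinuousMap.integral_apply hint κ
  rw [← hval]
  have hev := (continuous_eval.tendsto
    ((∫ x in Metric.closedBall 0 (k : ℝ), F.curry x ∂densityMeasure p), κ)).comp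
    (((hω k).mono_left hU).prodMk_nhds hlim)
  refine le_of_tendsto hev (Eventually.of_forall fun n => ?_)
  have hsum := (hg n).sum_mixture_div_le hΘ hσ (hmem γ)
  have hle : ∑ i ∈ Finset.range n,
      ((Metric.closedBall 0 (k : ℝ)).indicator F.curry (Y i ω)) (g n) ≤ n := by
    refine le_trans (Finset.sum_le_sum fun i _ => ?_) hsum
    by_cases hi : Y i ω ∈ Metric.closedBall (0 : Euc d) (k : ℝ)
    · rw [Set.indicator_of_mem hi, hFapply]
    · rw [Set.indicator_of_notMem hi]
      exact hFnonneg _ _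
  -- for `n = 0` the average is `0`, because `0⁻¹ = 0`
  simp only [Function.comp_apply, ContinuousMap.smul_apply, ContinuousMap.sum_apply, smul_eq_mul]
  exact (mul_le_mul_of_nonneg_left hle (by positivity)).trans inv_mul_le_one

/-- Jensen's inequality, read for `log (f_G / f_H)`. -/
theorem isRelKLProjection_of_lintegral_mixture_div_le_one {d : ℕ} {Θ : Set (Euc d)}
    (hΘ : IsCompact Θ) {σ : ℝ} (hσ : 0 < σ) {p : Euc d → ℝ} (hp : IsDensity p)
    {G : Measure (Euc d)} (hG : G ∈ probOn Θ) (h : ∀ H ∈ probOn Θ,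
      ∫⁻ x, ENNReal.ofReal (mixture σ H x / mixture σ G x) ∂densityMeasure p ≤ 1) :
    IsRelKLProjection Θ σ p G := by
  have := hp.isProbabilityMeasure
  refine ⟨hG, fun H hH => ?_⟩
  have := hG.1
  have := hH.1
  have ht0 (x : Euc d) : 0 < mixture σ H x / mixture σ G x :=
    div_pos (mixture_pos hσ H x) (mixture_pos hσ G x)
  have h1 := lintegral_ofReal_log_le_one ht0 (h H hH)
  have h2 := lintegral_log_le_lintegral_neg_log ((continuous_mixture hΘ σ hH).measurable.div
    (continuous_mixture hΘ σ hG).measurable) ht0 (h H hH)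
  simp only [Pi.div_apply, ← Real.log_inv, inv_div] at h1 h2 ⊢
  refine ⟨?_, h2⟩
  exact ne_top_of_le_ne_top ENNReal.one_ne_top h1

end GaussMix

end

theorem proposition2p1 {d : ℕ} (Θ : Set (GaussMix.Euc d)) (hΘ : IsCompact Θ)
    (hΘne : Θ.Nonempty) (σ : ℝ) (hσ : 0 < σ) (p₀ : GaussMix.Euc d → ℝ)
    (hp₀ : GaussMix.IsDensity p₀) :
    ∃ Gσ : Measure (GaussMix.Euc d), Gσ ∈ GaussMix.probOn Θ ∧
      -- `φ_σ * Gσ` is a KL projection of `p₀` ...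
      GaussMix.IsKLProjection Θ σ p₀ Gσ ∧
      -- ... and the only one, unless all the divergences are infinite;
      ((∃ H ∈ GaussMix.probOn Θ, GaussMix.KL p₀ (GaussMix.mixture σ H) ≠ ∞) →
        ∀ G, GaussMix.IsKLProjection Θ σ p₀ G → G = Gσ) ∧
      -- for every density it is the unique projection when divergences are compared through
      -- their differences;
      GaussMix.IsRelKLProjection Θ σ p₀ Gσ ∧
      (∀ G, GaussMix.IsRelKLProjection Θ σ p₀ G → G = Gσ) ∧
      -- the NPMLE exists for every sample ...
      (∀ (y : ℕ → GaussMix.Euc d) (n : ℕ), ∃ G, GaussMix.IsNPMLE Θ σ y n G) ∧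
      -- ... and, however it is chosen, converges to `Gσ` in every `W_r` almost surely.
      (∀ {Ω : Type*} [MeasurableSpace Ω] (μ : Measure Ω) [IsProbabilityMeasure μ]
        (Y : ℕ → Ω → GaussMix.Euc d), (∀ i, Measurable (Y i)) → iIndepFun Y μ →
        (∀ i, μ.map (Y i) = GaussMix.densityMeasure p₀) →
        ∀ r : ℝ, 1 ≤ r → ∀ᵐ ω ∂μ, ∀ Ghat : ℕ → Measure (GaussMix.Euc d),
          (∀ n, GaussMix.IsNPMLE Θ σ (fun i => Y i ω) n (Ghat n)) →
          Tendsto (fun n => GaussMix.wasserstein r (Ghat n) Gσ) atTop (𝓝 0)) := by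
  have := hp₀.isProbabilityMeasure
  have := isCompact_iff_compactSpace.1 hΘ
  obtain ⟨G, hG, hratio⟩ := GaussMix.exists_forall_lintegral_mixture_div_le_one hΘ hΘne hσ
    (GaussMix.densityMeasure p₀)
  have hpos {K : Measure (GaussMix.Euc d)} (hK : K ∈ GaussMix.probOn Θ) (x : GaussMix.Euc d) :
      0 < GaussMix.mixture σ K x := have := hK.1; GaussMix.mixture_pos hσ K x
  have hden {K : Measure (GaussMix.Euc d)} (hK : K ∈ GaussMix.probOn Θ) :=
    GaussMix.isDensity_mixture hΘ hσ hK
  have hKL : GaussMix.IsKLProjection Θ σ p₀ G := ⟨hG, fun H hH =>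
    GaussMix.KL_le_KL hp₀ (hden hG) (hden hH) (hpos hG) (hpos hH) (hratio H hH)⟩
  refine ⟨G, hG, hKL, ?_, GaussMix.isRelKLProjection_of_lintegral_mixture_div_le_one hΘ hσ hp₀ hG
    hratio, ?_, fun y n => GaussMix.exists_isNPMLE hΘ hΘne hσ y n, ?_⟩
  · rintro ⟨H, hH, hfin⟩ K hK
    exact GaussMix.eq_of_ae_mixture_div_eq_one hΘ hσ hp₀ hK.1 hG
      (GaussMix.ae_eq_of_KL_le_KL hp₀ (hden hG) (hden hK.1) (hpos hG) (hpos hK.1) (hratio K hK.1)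
        (hK.2 G hG) (ne_top_of_le_ne_top hfin (hKL.2 H hH)))
  · intro K hK
    exact GaussMix.eq_of_ae_mixture_div_eq_one hΘ hσ hp₀ hK.1 hG
      (GaussMix.ae_eq_one_of_lintegral_neg_log_le
        ((hden hK.1).measurable.div (hden hG).measurable)
        (fun x => div_pos (hpos hK.1 x) (hpos hG x)) (hratio K hK.1) (hK.2 G hG).2)
  · intro Ω _ μ _ Y hY hind hP r hr
    obtain ⟨γ, rfl⟩ := GaussMix.exists_extend_eq hΘ.measurableSet hG
    filter_upwards [GaussMix.ae_tendsto_of_isNPMLE hΘ hσ hp₀ hratio μ hY hind hP]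
      with ω hω Ghat hGhat
    choose g hg using fun n => GaussMix.exists_extend_eq hΘ.measurableSet (hGhat n).1
    have hlim := hω g fun n => by rw [hg n]; exact hGhat n
    simpa only [hg] using GaussMix.tendsto_wasserstein_extend hlim (one_pos.trans_le hr)
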